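/- Let $0<m\le n$ be integers. $\mathbb{R}^n$ carries its usual Euclidean structure and $\mathrm{Gr}(\mathbb{R}^n,m)$ is the Grassmannian of $m$-dimensional linear subspaces of $\mathbb{R}^n$, with its Borel $\sigma$-algebra; $\pi_V$ is the orthogonal projection onto $V$. For $\delta>0$ and a bounded set $A\subset\mathbb{R}^n$, $\mathcal{N}_\delta(A)$ is the minimal number of closed balls of radius $\delta$ needed to cover $A$. For $V\in\mathrm{Gr}(\mathbb{R}^n,m)$ and $W\in\mathrm{Gr}(\mathbb{R}^n,n-m)$ put $d_\measuredangle(V,W)=|\det(v_1,\dots,v_m,w_1,\dots,w_{n-m})|$, where $(v_i)$ and $(w_j)$ are orthonormal bases of $V$ and $W$, and for $\rho\ge 0$ let $\mathcal{V}_\measuredangle(W,\rho)=\{V\in\mathrm{Gr}(\mathbb{R}^n,m) : d_\measuredangle(V,W)\le\rho\}$. Let $0<\alpha<n$ and $\kappa>0$. There exists $C>1$, depending only on $n,m,\alpha,\kappa$, such that for every $0<\epsilon<\kappa/C$ there is $\delta_0>0$, depending only on $n,m,\alpha,\kappa,\epsilon$ (and $C$), such that the following holds for all $0<\delta<\delta_0$.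 Let $A$ be a subset of the closed unit ball of $\mathbb{R}^n$ and $\mu$ a probability measure on $\mathrm{Gr}(\mathbb{R}^n,m)$. Assume that $$\mathcal{N}_\delta(A)\ge\delta^{-\alpha-C\epsilon}$$ and, if $m<n$, that $$\mu\bigl(\mathcal{V}_\measuredangle(W,\rho)\bigr)\le\delta^{-\epsilon}\rho^{\kappa}\qquad\text{for all }\rho\ge\delta\text{ and all }W\in\mathrm{Gr}(\mathbb{R}^n,n-m).$$ Then $\mu(\mathcal{E}(A))\le\delta^{\epsilon}$, where $$\mathcal{E}(A)=\bigl\{V\in\mathrm{Gr}(\mathbb{R}^n,m) : \exists A'\subset A,\ \mathcal{N}_\delta(A')\ge\delta^{\epsilon}\mathcal{N}_\delta(A)\ \text{and}\ \mathcal{N}_\delta(\pi_V(A'))<\delta^{-\frac{m}{n}\alpha-\epsilon}\bigr\}$$ (if $\mathcal{E}(A)$ is not measurable, $\mu(\mathcal{E}(A))$ denotes its outer measure). -/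

import Mathlib

open MeasureTheory

noncomputable section

/-- The Grassmannian of `m`-dimensional linear subspaces of `ℝⁿ`, where `ℝⁿ` carries its usual
Euclidean structure. -/
def Gr (n m : ℕ) : Type :=
  {V : Submodule ℝ (EuclideanSpace ℝ (Fin n)) // Module.finrank ℝ V = m}

/-- The orthogonal projection `π_V` onto `V`, as an operator of `ℝⁿ`. -/
def Gr.proj {n m : ℕ} (V : Gr n m) : EuclideanSpace ℝ (Fin n) →L[ℝ] EuclideanSpace ℝ (Fin n) :=
  V.1.starProjection

/-- The usual topology of the Grassmannian: the one given by the distance `‖π_V - π_W‖`. -/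
instance (n m : ℕ) : TopologicalSpace (Gr n m) :=
  TopologicalSpace.induced Gr.proj inferInstance

/-- The Grassmannian carries its Borel `σ`-algebra. -/
instance (n m : ℕ) : MeasurableSpace (Gr n m) := borel (Gr n m)

instance (n m : ℕ) : BorelSpace (Gr n m) := ⟨rfl⟩

/-- The minimal number of closed balls of radius `δ` (with centres anywhere in `ℝⁿ`) that are
needed to cover `A`. It is used for bounded `A` and `δ > 0` only, and is then finite. -/
def Ncov {n : ℕ} (δ : ℝ) (A : Set (EuclideanSpace ℝ (Fin n))) : ℕ :=
  (Metric.externalCoveringNumber δ.toNNReal A).toNat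

/-- For `δ > 0` and `A` bounded, no information is lost in `Ncov`. -/
theorem Ncov_cast {n : ℕ} {δ : ℝ} (hδ : 0 < δ) {A : Set (EuclideanSpace ℝ (Fin n))}
    (hA : Bornology.IsBounded A) :
    (Ncov δ A : ℕ∞) = Metric.externalCoveringNumber δ.toNNReal A := by
  obtain ⟨N, -, hN, hc⟩ := Metric.exists_finite_isCover_of_totallyBounded
    (Real.toNNReal_pos.2 hδ).ne'
    (hA.isCompact_closure.totallyBounded.subset subset_closure)
  refine ENat.natCast_toNat (ne_top_of_le_ne_top (Set.encard_ne_top_iff.2 hN) ?_)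
  exact iInf₂_le N hc

/-- The `n × n` matrix with columns `v₁, …, v_m, w₁, …, w_{n-m}` (for `m ≤ n`). -/
def frameMatrix {n m : ℕ} (v : Fin m → EuclideanSpace ℝ (Fin n))
    (w : Fin (n - m) → EuclideanSpace ℝ (Fin n)) : Matrix (Fin n) (Fin n) ℝ :=
  Matrix.of fun i j => if h : (j : ℕ) < m then v ⟨j, h⟩ i else w ⟨j - m, by omega⟩ i

/-- An orthonormal basis of `V`. -/
def Gr.onb {n m : ℕ} (V : Gr n m) : OrthonormalBasis (Fin m) ℝ V.1 :=
  (stdOrthonormalBasis ℝ V.1).reindex (finCongr V.2)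

/-- `|det (v₁, …, v_m, w₁, …, w_{n-m})|`, where the `vᵢ` form an orthonormal basis of `V` and
the `wⱼ` one of `W`. The choice of the bases does not matter, see `dang_eq`. -/
def dang {n m : ℕ} (V : Gr n m) (W : Gr n (n - m)) : ℝ :=
  |(frameMatrix (fun i => (V.onb i : EuclideanSpace ℝ (Fin n)))
    (fun j => (W.onb j : EuclideanSpace ℝ (Fin n)))).det|

theorem dang_eq {n m : ℕ} (hm : m ≤ n) (V : Gr n m) (W : Gr n (n - m))
    (v : OrthonormalBasis (Fin m) ℝ V.1) (w : OrthonormalBasis (Fin (n - m)) ℝ W.1) :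
    dang V W = |(frameMatrix (fun i => (v i : EuclideanSpace ℝ (Fin n)))
      (fun j => (w j : EuclideanSpace ℝ (Fin n)))).det| := by
  have key : ∀ (k : ℕ) (U : Submodule ℝ (EuclideanSpace ℝ (Fin n)))
      (a b : OrthonormalBasis (Fin k) ℝ U), ∃ P : Matrix (Fin k) (Fin k) ℝ, |P.det| = 1 ∧
        ∀ i j, (a j : EuclideanSpace ℝ (Fin n)) i
          = ∑ l, (b l : EuclideanSpace ℝ (Fin n)) i * P l j := by
    intro k U a b
    refine ⟨b.toBasis.toMatrix a, ?_, fun i j => ?_⟩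
    · simpa [Module.Basis.det_apply] using b.det_to_matrix_orthonormalBasis a
    · have h := b.toBasis.sum_toMatrix_smul_self a j
      have h2 := congrArg (fun x : U => (x : EuclideanSpace ℝ (Fin n)) i) h
      simp at h2
      rw [← h2]
      exact Finset.sum_congr rfl fun l _ => mul_comm _ _
  obtain ⟨P, hP, hP'⟩ := key m V.1 V.onb v
  obtain ⟨Q, hQ, hQ'⟩ := key (n - m) W.1 W.onb w
  let e : Fin n ≃ Fin m ⊕ Fin (n - m) :=
    (finCongr (by omega)).trans (finSumFinEquiv (m := m) (n := n - m)).symm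
  have split : ∀ f : Fin n → ℝ, ∑ x, f x = ∑ y, f (e.symm y) :=
    fun f => (Equiv.sum_comp e.symm f).symm
  have el : ∀ l : Fin m, ((e.symm (Sum.inl l) : Fin n) : ℕ) = l := fun l => by simp [e]
  have er : ∀ l : Fin (n - m), ((e.symm (Sum.inr l) : Fin n) : ℕ) = m + l := fun l => by simp [e]
  have fl : ∀ (a : Fin m → EuclideanSpace ℝ (Fin n)) (b : Fin (n - m) → EuclideanSpace ℝ (Fin n))
      (i : Fin n) (l : Fin m), frameMatrix a b i (e.symm (Sum.inl l)) = a l i := by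
    intro a b i l
    simp [frameMatrix, el]
  have fr : ∀ (a : Fin m → EuclideanSpace ℝ (Fin n)) (b : Fin (n - m) → EuclideanSpace ℝ (Fin n))
      (i : Fin n) (l : Fin (n - m)), frameMatrix a b i (e.symm (Sum.inr l)) = b l i := by
    intro a b i l
    simp [frameMatrix, er]
  have hmul : frameMatrix (fun i => (V.onb i : EuclideanSpace ℝ (Fin n)))
        (fun j => (W.onb j : EuclideanSpace ℝ (Fin n)))
      = frameMatrix (fun i => (v i : EuclideanSpace ℝ (Fin n)))
        (fun j => (w j : EuclideanSpace ℝ (Fin n)))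
        * (Matrix.fromBlocks P 0 0 Q).submatrix e e := by
    ext i j
    obtain ⟨j, rfl⟩ := e.symm.surjective j
    rw [Matrix.mul_apply, split, Fintype.sum_sum_type]
    rcases j with j | j
    · simp only [fl, fr, hP' i j, Matrix.submatrix_apply, Equiv.apply_symm_apply,
        Matrix.fromBlocks_apply₁₁, Matrix.fromBlocks_apply₂₁, Matrix.zero_apply, mul_zero,
        Finset.sum_const_zero, add_zero]
    · simp only [fl, fr, hQ' i j, Matrix.submatrix_apply, Equiv.apply_symm_apply,
        Matrix.fromBlocks_apply₁₂, Matrix.fromBlocks_apply₂₂, Matrix.zero_apply, mul_zero,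
        Finset.sum_const_zero, zero_add]
  rw [dang, hmul, Matrix.det_mul, Matrix.det_submatrix_equiv_self, Matrix.det_fromBlocks_zero₂₁,
    abs_mul, abs_mul, hP, hQ, mul_one, mul_one]

/-- The set of all `V` with `dang V W ≤ ρ`. -/
def Vang {n m : ℕ} (W : Gr n (n - m)) (ρ : ℝ) : Set (Gr n m) := {V | dang V W ≤ ρ}

/-- The set of exceptional directions of `A` at scale `δ`: those `V` for which some `A' ⊆ A` has
`N_δ(A') ≥ δ ^ ε N_δ(A)` and `N_δ(π_V(A')) < δ ^ (- (m / n) α - ε)`. -/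
def exceptionalSet (n m : ℕ) (δ α ε : ℝ) (A : Set (EuclideanSpace ℝ (Fin n))) : Set (Gr n m) :=
  {V | ∃ A' ⊆ A, δ ^ ε * (Ncov δ A : ℝ) ≤ (Ncov δ A' : ℝ) ∧
    (Ncov δ (V.proj '' A') : ℝ) < δ ^ (-((m : ℝ) / n * α) - ε)}

end

/-! The proof combines entropy with a Brascamp–Lieb type inequality. For a finite set `B`, let H(U)
be the entropy, at scale about δ, of the projection to U of a uniformly random point of `B`. If V
makes a definite angle with U, or with a smaller U' such that U' + V = U + V, then H(U + V) + H(U ∩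
V) ≤ H(U) + H(V) up to the logarithm of the angle (`entropyAt_sup_add_inf_le`).

Take V₁, …, Vₙ of dimension m in general position. Start from U = 0 and replace U successively by U
+ Vᵢ if the dimensions add up to less than n, and by U ∩ Vᵢ otherwise, in which case U + Vᵢ = ℝⁿ.
The dimension of U is then the number of steps times m, reduced modulo n. After n steps U is 0 again
and the whole space has occurred m times, so m H(ℝⁿ) ≤ ∑ H(Vᵢ) up to the loss
(`mul_entropyAt_top_le`).

Suppose now that μ(E(A)) > δ^ε. Non-concentration at ρ = δ^(aε), a = (n + 3)/κ, allows a greedy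
choice of M ≈ δ^(-ε) members of E(A) in general position (`exists_transversalList`). Each V comes
with a part of A of proportion at least δ^ε, so by double counting some n of these parts share,
after discretisation, a set `B` that has lost only a factor M^(n+1)
(`exists_sublist_card_inter_ge`). On `B`, H(ℝⁿ) is nearly log |B|, while H(Vᵢ) is at most ((m/n)α +
ε) log(1/δ). The terms mα log(1/δ) cancel, and what remains bounds Cε log(1/δ) by smaller multiples
of ε log(1/δ) and constants, which is absurd for large C and small δ. -/

noncomputable section

/-! ### Counting cells of a cubic grid -/

/-- The cell of the cubic grid of side `s` that contains `x`. -/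
def gridCell {n : ℕ} (s : ℝ) (x : EuclideanSpace ℝ (Fin n)) : Fin n → ℤ := fun i => ⌊x i / s⌋

theorem norm_sub_le_of_gridCell_eq {n : ℕ} {s : ℝ} (hs : 0 < s) {x y : EuclideanSpace ℝ (Fin n)}
    (h : gridCell s x = gridCell s y) : ‖x - y‖ ≤ n * s := by
  have hi : ∀ i, |(x - y) i| ≤ s := by
    intro i
    have h1 : |x i / s - y i / s| < 1 := Int.abs_sub_lt_one_of_floor_eq_floor (congrFun h i)
    rw [← sub_div, abs_div, abs_of_pos hs, div_lt_one hs] at h1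
    exact h1.le
  rw [EuclideanSpace.norm_eq]
  refine Real.sqrt_le_iff.2 ⟨by positivity, ?_⟩
  calc ∑ i, ‖(x - y) i‖ ^ 2 ≤ ∑ _i : Fin n, s ^ 2 :=
        Finset.sum_le_sum fun i _ => pow_le_pow_left₀ (norm_nonneg _) (hi i) 2
    _ = n * s ^ 2 := by simp
    _ ≤ (n * s) ^ 2 := by
        rw [mul_pow]
        refine mul_le_mul_of_nonneg_right ?_ (sq_nonneg s)
        exact_mod_cast Nat.le_self_pow two_ne_zero n

theorem gridCell_mem_piFinset {n : ℕ} {s R : ℝ} (hs : 0 < s) {c x : EuclideanSpace ℝ (Fin n)}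
    (h : ‖x - c‖ ≤ R) :
    gridCell s x ∈ Fintype.piFinset fun i => Finset.Icc ⌊(c i - R) / s⌋ ⌊(c i + R) / s⌋ := by
  rw [Fintype.mem_piFinset]
  intro i
  have h1 := abs_le.1 ((PiLp.norm_apply_le (x - c) i).trans h)
  simp only [PiLp.sub_apply] at h1
  rw [Finset.mem_Icc]
  exact ⟨Int.floor_le_floor (by gcongr; linarith), Int.floor_le_floor (by gcongr; linarith)⟩

theorem card_image_gridCell_le {n : ℕ} {s R : ℝ} (hs : 0 < s) (hR : 0 ≤ R)
    (c : EuclideanSpace ℝ (Fin n)) {ι : Type*} (T : Finset ι) (f : ι → EuclideanSpace ℝ (Fin n))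
    (hT : ∀ x ∈ T, ‖f x - c‖ ≤ R) :
    ((T.image fun x => gridCell s (f x)).card : ℝ) ≤ (2 * R / s + 2) ^ n := by
  have hsub : (T.image fun x => gridCell s (f x)) ⊆
      Fintype.piFinset fun i => Finset.Icc ⌊(c i - R) / s⌋ ⌊(c i + R) / s⌋ := by
    intro z hz
    obtain ⟨x, hx, rfl⟩ := Finset.mem_image.1 hz
    exact gridCell_mem_piFinset hs (hT x hx)
  calc ((T.image fun x => gridCell s (f x)).card : ℝ)
      ≤ ((Fintype.piFinset fun i => Finset.Icc ⌊(c i - R) / s⌋ ⌊(c i + R) / s⌋).card : ℝ) := by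
        exact_mod_cast Finset.card_le_card hsub
    _ = ∏ i : Fin n, ((Finset.Icc ⌊(c i - R) / s⌋ ⌊(c i + R) / s⌋).card : ℝ) := by
        rw [Fintype.card_piFinset]; push_cast; rfl
    _ ≤ ∏ _i : Fin n, (2 * R / s + 2) := by
        refine Finset.prod_le_prod (fun _ _ => Nat.cast_nonneg _) fun i _ => ?_
        have hle : ⌊(c i - R) / s⌋ ≤ ⌊(c i + R) / s⌋ :=
          Int.floor_le_floor (by gcongr; linarith)
        rw [Int.card_Icc]
        have : (((⌊(c i + R) / s⌋ + 1 - ⌊(c i - R) / s⌋).toNat : ℤ) : ℝ)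
            = (⌊(c i + R) / s⌋ : ℝ) + 1 - ⌊(c i - R) / s⌋ := by
          rw [Int.toNat_of_nonneg (by omega)]; push_cast; ring
        rw [Int.cast_natCast] at this
        rw [this]
        have h1 := Int.floor_le ((c i + R) / s)
        have h2 := Int.lt_floor_add_one ((c i - R) / s)
        have h3 : (c i + R) / s - (c i - R) / s = 2 * R / s := by ring
        linarith
    _ = (2 * R / s + 2) ^ n := by simp

/-! ### Entropy of images of a finite set, through local counts -/

section Counting

variable {E : Type*} [NormedAddCommGroup E] [NormedSpace ℝ E]

/-- The number of points of `B` whose image under `L` is at distance at most `r` from `L b`. -/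
def nbrCount (B : Finset E) (L : E →L[ℝ] E) (r : ℝ) (b : E) : ℕ := by
  classical exact (B.filter fun c => ‖L (b - c)‖ ≤ r).card

/-- The sum over `b ∈ B` of the logarithms of the local counts; up to normalisation it is
`log |B|` minus the entropy at scale `r` of the image under `L` of a random point of `B`. -/
def logSum (B : Finset E) (L : E →L[ℝ] E) (r : ℝ) : ℝ := ∑ b ∈ B, Real.log (nbrCount B L r b)

theorem nbrCount_pos {B : Finset E} {L : E →L[ℝ] E} {r : ℝ} (hr : 0 ≤ r) {b : E} (hb : b ∈ B) :
    0 < nbrCount B L r b := by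
  classical
  exact Finset.card_pos.2 ⟨b, by simp [hb, hr]⟩

theorem card_le_nbrCount {B T : Finset E} {L : E →L[ℝ] E} {r : ℝ} {b : E} (hT : T ⊆ B)
    (h : ∀ c ∈ T, ‖L (b - c)‖ ≤ r) : T.card ≤ nbrCount B L r b := by
  classical
  exact Finset.card_le_card fun c hc => Finset.mem_filter.2 ⟨hT hc, h c hc⟩

/-- Every point of a fibre of `g` in `T` has the whole fibre among its neighbours, so each fibre
contributes at most 1. -/
theorem sum_inv_nbrCount_le {ι : Type*} [DecidableEq ι] {B T : Finset E} {L : E →L[ℝ] E} {r : ℝ}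
    (hT : T ⊆ B) (g : E → ι) (hg : ∀ x ∈ T, ∀ y ∈ T, g x = g y → ‖L (x - y)‖ ≤ r) :
    ∑ b ∈ T, (nbrCount B L r b : ℝ)⁻¹ ≤ (T.image g).card := by
  classical
  rw [← Finset.sum_fiberwise_of_maps_to (t := T.image g) (g := g)
    (fun x hx => Finset.mem_image_of_mem g hx)]
  rw [Finset.card_eq_sum_ones, Nat.cast_sum]
  refine Finset.sum_le_sum fun i hi => ?_
  set F := T.filter fun x => g x = i
  have hF : F.Nonempty := by
    obtain ⟨x, hx, hxi⟩ := Finset.mem_image.1 hi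
    exact ⟨x, Finset.mem_filter.2 ⟨hx, hxi⟩⟩
  have hcard : (0 : ℝ) < F.card := by exact_mod_cast hF.card_pos
  calc ∑ b ∈ F, (nbrCount B L r b : ℝ)⁻¹ ≤ ∑ _b ∈ F, (F.card : ℝ)⁻¹ := by
        refine Finset.sum_le_sum fun b hb => inv_anti₀ hcard ?_
        have hb' := Finset.mem_filter.1 hb
        exact_mod_cast card_le_nbrCount ((Finset.filter_subset _ _).trans hT) fun c hc =>
          hg b hb'.1 c (Finset.mem_filter.1 hc).1 (by rw [hb'.2, (Finset.mem_filter.1 hc).2])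
    _ = ((1 : ℕ) : ℝ) := by simp [hcard.ne']

/-- Jensen's inequality for the logarithm, from log t ≤ t - 1. It reduces the entropy inequalities
to bounds on averages. -/
theorem sum_log_le {ι : Type*} (B : Finset ι) (q : ι → ℝ) {K : ℝ} (hK : 0 < K)
    (hq : ∀ b ∈ B, 0 < q b) (h : ∑ b ∈ B, q b ≤ B.card * K) :
    ∑ b ∈ B, Real.log (q b) ≤ B.card * Real.log K := by
  have h1 : ∀ b ∈ B, Real.log (q b) ≤ Real.log K + (q b / K - 1) := by
    intro b hb
    have := Real.log_le_sub_one_of_pos (div_pos (hq b hb) hK)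
    rw [Real.log_div (hq b hb).ne' hK.ne'] at this
    linarith
  calc ∑ b ∈ B, Real.log (q b) ≤ ∑ b ∈ B, (Real.log K + (q b / K - 1)) := Finset.sum_le_sum h1
    _ = B.card * Real.log K + ((∑ b ∈ B, q b) / K - B.card) := by
        rw [Finset.sum_add_distrib, Finset.sum_sub_distrib, Finset.sum_div]; simp
    _ ≤ B.card * Real.log K := by
        have : (∑ b ∈ B, q b) / K ≤ B.card := by rwa [div_le_iff₀ hK]
        linarith

/-- The entropy is at most the logarithm of the number of sets of small diameter needed to
cover the image. -/
theorem le_logSum_of_cover {ι : Type*} [DecidableEq ι] {B : Finset E} (hB : B.Nonempty)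
    {L : E →L[ℝ] E} {r : ℝ} (hr : 0 ≤ r) (g : E → ι)
    (hg : ∀ x ∈ B, ∀ y ∈ B, g x = g y → ‖L (x - y)‖ ≤ r) {R : ℝ}
    (hR : ((B.image g).card : ℝ) ≤ R) :
    B.card * (Real.log B.card - Real.log R) ≤ logSum B L r := by
  have hBc : (0 : ℝ) < B.card := by exact_mod_cast hB.card_pos
  have hRpos : 0 < R := lt_of_lt_of_le (by exact_mod_cast (hB.image g).card_pos) hR
  have h := sum_log_le B (fun b => (nbrCount B L r b : ℝ)⁻¹) (div_pos hRpos hBc)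
    (fun b hb => inv_pos.2 (by exact_mod_cast nbrCount_pos hr hb))
    (by rw [mul_div_cancel₀ _ hBc.ne']
        exact (sum_inv_nbrCount_le (L := L) (r := r) subset_rfl g hg).trans hR)
  simp only [Real.log_inv, Finset.sum_neg_distrib] at h
  rw [Real.log_div hRpos.ne' hBc.ne'] at h
  unfold logSum
  linarith

theorem nbrCount_eq_sum (B : Finset E) (L : E →L[ℝ] E) (r : ℝ) (b : E) [DecidablePred
    fun c => ‖L (b - c)‖ ≤ r] :
    (nbrCount B L r b : ℝ) = ∑ c ∈ B, if ‖L (b - c)‖ ≤ r then 1 else 0 := by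
  rw [Finset.sum_boole, nbrCount]
  congr

theorem norm_map_sub_comm (L : E →L[ℝ] E) (b c : E) : ‖L (b - c)‖ = ‖L (c - b)‖ := by
  rw [← norm_neg, ← map_neg, neg_sub]

/-- Submodularity of the entropy. -/
theorem logSum_add_le {B : Finset E} {P Q S I : E →L[ℝ] E} {r r' : ℝ} (hr : 0 ≤ r) (hr' : 0 ≤ r')
    (hS : ∀ x, ‖P x‖ ≤ 2 * r → ‖Q x‖ ≤ 2 * r → ‖S x‖ ≤ r')
    (hIP : ∀ x, ‖I x‖ ≤ ‖P x‖) (hIQ : ∀ x, ‖I x‖ ≤ ‖Q x‖) :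
    logSum B P r + logSum B Q r ≤ logSum B S r' + logSum B I (3 * r) := by
  classical
  have pos : ∀ (L : E →L[ℝ] E) {t : ℝ}, 0 ≤ t → ∀ b ∈ B, (0 : ℝ) < nbrCount B L t b :=
    fun L t ht b hb => by exact_mod_cast nbrCount_pos ht hb
  -- It suffices to bound an average by 1. Expand the product of the counts for `P` and `Q` into
  -- pairs (c, d). All b that belong to one pair are r'-close under `S`, so their weights sum to at
  -- most 1; for fixed c the remaining weights sum to 1 over the d with `I d` within 2r of `I c`.
  have key : ∑ b ∈ B, (nbrCount B P r b : ℝ) * nbrCount B Q r b *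
      ((nbrCount B S r' b : ℝ)⁻¹ * (nbrCount B I (3 * r) b : ℝ)⁻¹) ≤ B.card * 1 := by
    have hpt : ∀ b ∈ B, (nbrCount B P r b : ℝ) * nbrCount B Q r b *
        ((nbrCount B S r' b : ℝ)⁻¹ * (nbrCount B I (3 * r) b : ℝ)⁻¹) ≤
        ∑ c ∈ B, ∑ d ∈ B, if ‖I (c - d)‖ ≤ 2 * r then
          (nbrCount B I (2 * r) c : ℝ)⁻¹ *
            (if ‖P (b - c)‖ ≤ r ∧ ‖Q (b - d)‖ ≤ r then (nbrCount B S r' b : ℝ)⁻¹ else 0)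
          else 0 := by
      intro b hb
      rw [nbrCount_eq_sum B P, nbrCount_eq_sum B Q, Finset.sum_mul_sum, Finset.sum_mul]
      refine Finset.sum_le_sum fun c hc => ?_
      rw [Finset.sum_mul]
      refine Finset.sum_le_sum fun d hd => ?_
      by_cases h1 : ‖P (b - c)‖ ≤ r
      · by_cases h2 : ‖Q (b - d)‖ ≤ r
        · have hIc : ‖I (b - c)‖ ≤ r := (hIP _).trans h1
          have hId : ‖I (b - d)‖ ≤ r := (hIQ _).trans h2
          have hcd : ‖I (c - d)‖ ≤ 2 * r := by
            have : I (c - d) = I (b - d) - I (b - c) := by rw [← map_sub]; congr 1; abel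
            rw [this]
            linarith [norm_sub_le (I (b - d)) (I (b - c))]
          -- Moving the centre from b to c makes the weight independent of b; this is why `I` needs
          -- the radius 3r.
          have hle : nbrCount B I (2 * r) c ≤ nbrCount B I (3 * r) b := by
            refine card_le_nbrCount (Finset.filter_subset _ _) fun e he => ?_
            have he' := (Finset.mem_filter.1 he).2
            have : I (b - e) = I (b - c) + I (c - e) := by rw [← map_add]; congr 1; abel
            rw [this]
            linarith [norm_add_le (I (b - c)) (I (c - e))]
          rw [if_pos h1, if_pos h2, if_pos hcd, if_pos ⟨h1, h2⟩, one_mul, one_mul, mul_comm]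
          refine mul_le_mul_of_nonneg_right ?_ (by positivity)
          exact inv_anti₀ (pos I (by positivity) c hc) (by exact_mod_cast hle)
        · rw [if_neg h2, mul_zero, zero_mul]
          split_ifs <;> positivity
      · rw [if_neg h1, zero_mul, zero_mul]
        split_ifs <;> positivity
    refine (Finset.sum_le_sum hpt).trans ?_
    rw [Finset.sum_comm, ← nsmul_eq_mul]
    refine Finset.sum_le_card_nsmul _ _ _ fun c hc => ?_
    rw [Finset.sum_comm]
    calc ∑ d ∈ B, ∑ b ∈ B, (if ‖I (c - d)‖ ≤ 2 * r then
          (nbrCount B I (2 * r) c : ℝ)⁻¹ *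
            (if ‖P (b - c)‖ ≤ r ∧ ‖Q (b - d)‖ ≤ r then (nbrCount B S r' b : ℝ)⁻¹ else 0)
          else 0)
        ≤ ∑ d ∈ B, (nbrCount B I (2 * r) c : ℝ)⁻¹ * if ‖I (c - d)‖ ≤ 2 * r then 1 else 0 := by
          refine Finset.sum_le_sum fun d hd => ?_
          split_ifs with h
          · rw [← Finset.mul_sum]
            refine mul_le_mul_of_nonneg_left ?_ (by positivity)
            rw [← Finset.sum_filter]
            -- Constant labelling: all these b form a single fibre.
            refine (sum_inv_nbrCount_le (Finset.filter_subset _ _) (fun _ => ()) ?_).trans ?_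
            · intro x hx y hy _
              have hx' := (Finset.mem_filter.1 hx).2
              have hy' := (Finset.mem_filter.1 hy).2
              refine hS _ ?_ ?_
              · have : P (x - y) = P (x - c) - P (y - c) := by rw [← map_sub]; congr 1; abel
                rw [this]
                linarith [norm_sub_le (P (x - c)) (P (y - c)), hx'.1, hy'.1]
              · have : Q (x - y) = Q (x - d) - Q (y - d) := by rw [← map_sub]; congr 1; abel
                rw [this]
                linarith [norm_sub_le (Q (x - d)) (Q (y - d)), hx'.2, hy'.2]
            · exact_mod_cast Finset.card_le_univ _
          · simp
      _ = 1 := by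
          rw [← Finset.mul_sum, ← nbrCount_eq_sum]
          exact inv_mul_cancel₀ (pos I (by positivity) c hc).ne'
  have h := sum_log_le B _ one_pos (fun b hb => mul_pos
    (mul_pos (pos P hr b hb) (pos Q hr b hb))
    (mul_pos (inv_pos.2 (pos S hr' b hb)) (inv_pos.2 (pos I (by positivity) b hb)))) key
  rw [Real.log_one, mul_zero] at h
  have e : ∀ b ∈ B, Real.log ((nbrCount B P r b : ℝ) * nbrCount B Q r b *
      ((nbrCount B S r' b : ℝ)⁻¹ * (nbrCount B I (3 * r) b : ℝ)⁻¹)) =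
      Real.log (nbrCount B P r b) + Real.log (nbrCount B Q r b)
        - Real.log (nbrCount B S r' b) - Real.log (nbrCount B I (3 * r) b) := by
    intro b hb
    have p1 := (pos P hr b hb).ne'
    have p2 := (pos Q hr b hb).ne'
    have p3 := (pos S hr' b hb).ne'
    have p4 := (pos I (show 0 ≤ 3 * r by positivity) b hb).ne'
    rw [Real.log_mul (mul_ne_zero p1 p2) (mul_ne_zero (inv_ne_zero p3) (inv_ne_zero p4)),
      Real.log_mul p1 p2, Real.log_mul (inv_ne_zero p3) (inv_ne_zero p4), Real.log_inv,
      Real.log_inv]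
    ring
  rw [Finset.sum_congr rfl e, Finset.sum_sub_distrib, Finset.sum_sub_distrib,
    Finset.sum_add_distrib] at h
  unfold logSum
  linarith

end Counting

/-- Local counts at radii r and tr need not be comparable point by point, but they are on average.
After exchanging the sums over b and c, the points near c fall into at most (2nt + 2)^n ≤ (4nt)^n
cells of diameter at most r, and each cell contributes at most 1. -/
theorem logSum_scale_le {n : ℕ} (hn : 0 < n) (B : Finset (EuclideanSpace ℝ (Fin n)))
    (L : EuclideanSpace ℝ (Fin n) →L[ℝ] EuclideanSpace ℝ (Fin n)) {r t : ℝ} (hr : 0 < r)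
    (ht : 1 ≤ t) : logSum B L (t * r) ≤ logSum B L r + B.card * (n * Real.log (4 * n * t)) := by
  classical
  have hn' : (1 : ℝ) ≤ n := by exact_mod_cast hn
  have hs : 0 < r / n := by positivity
  have pos : ∀ {u : ℝ}, 0 ≤ u → ∀ b ∈ B, (0 : ℝ) < nbrCount B L u b :=
    fun hu b hb => by exact_mod_cast nbrCount_pos hu hb
  have key : ∑ b ∈ B, (nbrCount B L (t * r) b : ℝ) * (nbrCount B L r b : ℝ)⁻¹
      ≤ B.card * (4 * n * t) ^ n := by
    have e : ∀ b ∈ B, (nbrCount B L (t * r) b : ℝ) * (nbrCount B L r b : ℝ)⁻¹ =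
        ∑ c ∈ B, if ‖L (b - c)‖ ≤ t * r then (nbrCount B L r b : ℝ)⁻¹ else 0 := by
      intro b _
      rw [nbrCount_eq_sum B L (t * r), Finset.sum_mul]
      exact Finset.sum_congr rfl fun c _ => by split_ifs <;> simp
    rw [Finset.sum_congr rfl e, Finset.sum_comm, ← nsmul_eq_mul]
    refine Finset.sum_le_card_nsmul _ _ _ fun c hc => ?_
    rw [← Finset.sum_filter]
    refine (sum_inv_nbrCount_le (Finset.filter_subset _ _)
      (fun x => gridCell (r / n) (L x)) ?_).trans ?_
    · intro x _ y _ hxy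
      have := norm_sub_le_of_gridCell_eq hs hxy
      rwa [mul_div_cancel₀ _ (by positivity), ← map_sub] at this
    · refine (card_image_gridCell_le hs (by positivity) (L c) _ (fun x => L x) (R := t * r)
        fun x hx => ?_).trans ?_
      · rw [← map_sub]
        exact (Finset.mem_filter.1 hx).2
      · refine pow_le_pow_left₀ (by positivity) ?_ n
        have : 2 * (t * r) / (r / n) = 2 * (n * t) := by field_simp
        rw [this]
        nlinarith
  have h := sum_log_le B _ (by positivity) (fun b hb => mul_pos (pos (by positivity) b hb)
    (inv_pos.2 (pos hr.le b hb))) key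
  have e : ∀ b ∈ B, Real.log ((nbrCount B L (t * r) b : ℝ) * (nbrCount B L r b : ℝ)⁻¹) =
      Real.log (nbrCount B L (t * r) b) - Real.log (nbrCount B L r b) := by
    intro b hb
    rw [Real.log_mul (pos (by positivity) b hb).ne' (inv_ne_zero (pos hr.le b hb).ne'),
      Real.log_inv]
    ring
  rw [Finset.sum_congr rfl e, Finset.sum_sub_distrib, Real.log_pow] at h
  unfold logSum
  linarith

/-! ### Angles between subspaces and orthogonal projections -/

section Geometry

variable {n m : ℕ}

theorem Gr.proj_def (V : Gr n m) : V.proj = V.1.starProjection := rfl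

theorem Submodule.exists_le_finrank_eq {E : Type*} [NormedAddCommGroup E] [InnerProductSpace ℝ E]
    [FiniteDimensional ℝ E] (U : Submodule ℝ E) {k : ℕ} (hk : k ≤ Module.finrank ℝ U) :
    ∃ W ≤ U, Module.finrank ℝ W = k := by
  let b := stdOrthonormalBasis ℝ U
  let f : Fin k → E := fun i => (b (Fin.castLE hk i) : E)
  have hli : LinearIndependent ℝ f :=
    (b.toBasis.linearIndependent.map' U.subtype U.ker_subtype).comp _
      (Fin.castLE_injective hk) |> fun h => by simpa [f, Function.comp_def] using h
  refine ⟨Submodule.span ℝ (Set.range f), Submodule.span_le.2 ?_, ?_⟩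
  · rintro _ ⟨i, rfl⟩
    exact (b _).2
  · rw [finrank_span_eq_card hli, Fintype.card_fin]

/-- The non-concentration hypothesis only concerns subspaces of dimension n - m. A subspace U of
another dimension is therefore enlarged or shrunk to that dimension. -/
theorem exists_comparable_subspace (hmn : m ≤ n)
    (U : Submodule ℝ (EuclideanSpace ℝ (Fin n))) :
    ∃ W : Gr n (n - m), (Module.finrank ℝ U + m < n → U ≤ W.1) ∧
      (n ≤ Module.finrank ℝ U + m → W.1 ≤ U) := by
  by_cases h : n ≤ Module.finrank ℝ U + m
  · obtain ⟨W, hW, hd⟩ := Submodule.exists_le_finrank_eq U (k := n - m) (by omega)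
    exact ⟨⟨W, hd⟩, fun h' => absurd h (by omega), fun _ => hW⟩
  · have hU := U.finrank_add_finrank_orthogonal
    rw [finrank_euclideanSpace_fin] at hU
    obtain ⟨W, hW, hd⟩ := Submodule.exists_le_finrank_eq Uᗮ (k := m) (by omega)
    have hW' := W.finrank_add_finrank_orthogonal
    rw [finrank_euclideanSpace_fin] at hW'
    refine ⟨⟨Wᗮ, by omega⟩, fun _ => ?_, fun h' => absurd h' h⟩
    exact (Submodule.le_orthogonal_orthogonal U).trans (Submodule.orthogonal_le hW)

/-- A subspace of dimension `n - m` which contains `U` or is contained in `U`. -/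
def comparableSubspace (hmn : m ≤ n) (U : Submodule ℝ (EuclideanSpace ℝ (Fin n))) :
    Gr n (n - m) := (exists_comparable_subspace hmn U).choose

theorem abs_frameMatrix_le_one {v : Fin m → EuclideanSpace ℝ (Fin n)}
    {w : Fin (n - m) → EuclideanSpace ℝ (Fin n)} (hv : ∀ i, ‖v i‖ = 1) (hw : ∀ i, ‖w i‖ = 1)
    (i j : Fin n) : |frameMatrix v w i j| ≤ 1 := by
  unfold frameMatrix
  rw [Matrix.of_apply]
  split_ifs with h
  · exact (PiLp.norm_apply_le (v _) i).trans (hv _).le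
  · exact (PiLp.norm_apply_le (w _) i).trans (hw _).le

theorem abs_adjugate_le {M : Matrix (Fin n) (Fin n) ℝ} (hM : ∀ i j, |M i j| ≤ 1) (i j : Fin n) :
    |M.adjugate i j| ≤ n.factorial := by
  rw [Matrix.adjugate_apply]
  have := Matrix.det_le (A := M.updateRow j (Pi.single i 1)) (abv := AbsoluteValue.abs) (x := 1)
    fun a b => by
      rw [AbsoluteValue.abs_apply, Matrix.updateRow_apply]
      split_ifs
      · by_cases hb : b = i <;> simp [hb]
      · exact hM a b
  simpa using this

/-- Cramer's rule: det M · c = adj M · (M c), and the entries of the adjugate are at most n!. -/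
theorem abs_det_mul_le {M : Matrix (Fin n) (Fin n) ℝ} (hM : ∀ i j, |M i j| ≤ 1) (c : Fin n → ℝ)
    {t : ℝ} (ht : ∀ i, |(M.mulVec c) i| ≤ t) (i : Fin n) :
    |M.det| * |c i| ≤ n * (n.factorial * t) := by
  have h : M.adjugate.mulVec (M.mulVec c) = M.det • c := by
    rw [Matrix.mulVec_mulVec, Matrix.adjugate_mul, Matrix.smul_mulVec, Matrix.one_mulVec]
  rw [← abs_mul, ← smul_eq_mul, ← Pi.smul_apply, ← h]
  calc |(M.adjugate.mulVec (M.mulVec c)) i| = |∑ j, M.adjugate i j * (M.mulVec c) j| := rfl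
    _ ≤ ∑ j, |M.adjugate i j * (M.mulVec c) j| := Finset.abs_sum_le_sum_abs _ _
    _ ≤ ∑ _j : Fin n, (n.factorial * t : ℝ) := Finset.sum_le_sum fun j _ => by
        rw [abs_mul]
        exact mul_le_mul (abs_adjugate_le hM i j) (ht j) (abs_nonneg _) (by positivity)
    _ = n * (n.factorial * t) := by simp

/-- Cramer's rule for the coordinates of v + w in the two orthonormal bases. It turns a lower bound
on the determinant into quantitative independence of V and W. -/
theorem dang_mul_norm_le (hmn : m ≤ n) (V : Gr n m) (W : Gr n (n - m))
    {v w : EuclideanSpace ℝ (Fin n)} (hv : v ∈ V.1) (hw : w ∈ W.1) :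
    dang V W * ‖v‖ ≤ n ^ 2 * n.factorial * ‖v + w‖ := by
  set a : Fin m → ℝ := fun i => V.onb.repr ⟨v, hv⟩ i
  set b : Fin (n - m) → ℝ := fun i => W.onb.repr ⟨w, hw⟩ i
  have hva : ∑ i, a i • (V.onb i : EuclideanSpace ℝ (Fin n)) = v := by
    have := congrArg Subtype.val (V.onb.sum_repr ⟨v, hv⟩)
    simpa [a] using this
  have hwb : ∑ i, b i • (W.onb i : EuclideanSpace ℝ (Fin n)) = w := by
    have := congrArg Subtype.val (W.onb.sum_repr ⟨w, hw⟩)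
    simpa [b] using this
  have hVn : ∀ i, ‖(V.onb i : EuclideanSpace ℝ (Fin n))‖ = 1 := fun i => V.onb.orthonormal.1 i
  have hWn : ∀ i, ‖(W.onb i : EuclideanSpace ℝ (Fin n))‖ = 1 := fun i => W.onb.orthonormal.1 i
  set M := frameMatrix (fun i => (V.onb i : EuclideanSpace ℝ (Fin n)))
    (fun j => (W.onb j : EuclideanSpace ℝ (Fin n)))
  let e : Fin m ⊕ Fin (n - m) ≃ Fin n :=
    (finSumFinEquiv (m := m) (n := n - m)).trans (finCongr (by omega))
  have el : ∀ l : Fin m, ((e (Sum.inl l) : Fin n) : ℕ) = l := fun l => by simp [e]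
  have er : ∀ l : Fin (n - m), ((e (Sum.inr l) : Fin n) : ℕ) = m + l := fun l => by simp [e]
  have hMl : ∀ i l, M i (e (Sum.inl l)) = (V.onb l : EuclideanSpace ℝ (Fin n)) i := by
    intro i l
    simp [M, frameMatrix, el]
  have hMr : ∀ i l, M i (e (Sum.inr l)) = (W.onb l : EuclideanSpace ℝ (Fin n)) i := by
    intro i l
    simp [M, frameMatrix, er]
  let c : Fin n → ℝ := fun i => Sum.elim a b (e.symm i)
  have hMc : ∀ i, (M.mulVec c) i = (v + w) i := by
    intro i
    have : (M.mulVec c) i = ∑ j, M i j * c j := rfl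
    rw [this, ← e.sum_comp, Fintype.sum_sum_type, PiLp.add_apply, ← hva, ← hwb]
    simp only [hMl, hMr, c, e.symm_apply_apply, Sum.elim_inl, Sum.elim_inr, WithLp.ofLp_sum,
      WithLp.ofLp_smul, Finset.sum_apply, Pi.smul_apply, smul_eq_mul]
    congr 1 <;> exact Finset.sum_congr rfl fun _ _ => mul_comm _ _
  have hc := abs_det_mul_le (M := M) (abs_frameMatrix_le_one hVn hWn) c (t := ‖v + w‖)
    (fun i => by rw [hMc]; exact PiLp.norm_apply_le (v + w) i)
  have hdang : dang V W = |M.det| := rfl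
  calc dang V W * ‖v‖ ≤ dang V W * ∑ i, |a i| := by
        refine mul_le_mul_of_nonneg_left ?_ (abs_nonneg _)
        conv_lhs => rw [← hva]
        refine (norm_sum_le _ _).trans (Finset.sum_le_sum fun i _ => ?_)
        rw [norm_smul, hVn, mul_one, Real.norm_eq_abs]
    _ = ∑ i, |M.det| * |c (e (Sum.inl i))| := by
        rw [hdang, Finset.mul_sum]; simp [c]
    _ ≤ ∑ _i : Fin m, (n * (n.factorial * ‖v + w‖) : ℝ) := Finset.sum_le_sum fun i _ => hc _
    _ = m * (n * (n.factorial * ‖v + w‖)) := by simp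
    _ ≤ n * (n * (n.factorial * ‖v + w‖)) := by gcongr
    _ = n ^ 2 * n.factorial * ‖v + w‖ := by ring

/-- Write the projection y of x to U + V as u + v. Then ‖y‖² = ⟨x, y⟩ = ⟨π_U x, u⟩ + ⟨π_V x, v⟩, and
the angle condition bounds ‖u‖ and ‖v‖ by multiples of ‖y‖. -/
theorem norm_starProjection_sup_le {E : Type*} [NormedAddCommGroup E] [InnerProductSpace ℝ E]
    [FiniteDimensional ℝ E] {U V : Submodule ℝ E} {K : ℝ} (hK : 0 ≤ K)
    (h : ∀ v ∈ V, ∀ u ∈ U, ‖v‖ ≤ K * ‖v + u‖) {x : E} {t : ℝ}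
    (hV : ‖V.starProjection x‖ ≤ t) (hU : ‖U.starProjection x‖ ≤ t) :
    ‖(U ⊔ V).starProjection x‖ ≤ (2 * K + 1) * t := by
  set y := (U ⊔ V).starProjection x
  have ht : 0 ≤ t := (norm_nonneg _).trans hV
  obtain ⟨u, hu, v, hv, huv⟩ := Submodule.mem_sup.1 ((U ⊔ V).starProjection_apply_mem x)
  have key : ∀ (X : Submodule ℝ E) (z : E), z ∈ X → inner ℝ x z = inner ℝ (X.starProjection x) z := by
    intro X z hz
    have := X.starProjection_inner_eq_zero x z hz
    rw [inner_sub_left] at this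
    linarith
  have hv1 : ‖v‖ ≤ K * ‖y‖ := by
    have := h v hv u hu
    rwa [add_comm, huv] at this
  have hu1 : ‖u‖ ≤ (K + 1) * ‖y‖ := by
    have : u = y - v := by rw [eq_sub_iff_add_eq]; exact huv
    rw [this]
    linarith [norm_sub_le y v]
  have hy : ‖y‖ * ‖y‖ ≤ (2 * K + 1) * t * ‖y‖ := by
    calc ‖y‖ * ‖y‖ = inner ℝ y y := (real_inner_self_eq_norm_mul_norm y).symm
      _ = inner ℝ x y := (key _ _ ((U ⊔ V).starProjection_apply_mem x)).symm
      _ = inner ℝ x u + inner ℝ x v := by rw [← inner_add_right, huv]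
      _ = inner ℝ (U.starProjection x) u + inner ℝ (V.starProjection x) v := by
          rw [key U u hu, key V v hv]
      _ ≤ ‖U.starProjection x‖ * ‖u‖ + ‖V.starProjection x‖ * ‖v‖ :=
          add_le_add (real_inner_le_norm _ _) (real_inner_le_norm _ _)
      _ ≤ t * ((K + 1) * ‖y‖) + t * (K * ‖y‖) := by gcongr
      _ = (2 * K + 1) * t * ‖y‖ := by ring
  rcases (norm_nonneg y).eq_or_lt with h0 | h0
  · rw [← h0]; positivity
  · exact le_of_mul_le_mul_right hy h0

theorem norm_starProjection_mono {E : Type*} [NormedAddCommGroup E] [InnerProductSpace ℝ E]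
    [FiniteDimensional ℝ E] {U V : Submodule ℝ E} (h : U ≤ V) (x : E) :
    ‖U.starProjection x‖ ≤ ‖V.starProjection x‖ := by
  have : U.starProjection x = U.starProjection (V.starProjection x) := by
    rw [← ContinuousLinearMap.comp_apply, Submodule.starProjection_comp_starProjection_of_le h]
  rw [this]
  exact U.norm_starProjection_apply_le _

/-! ### Euclid's algorithm and the Brascamp–Lieb type inequality -/

/-- Euclid's algorithm on subspaces: as long as the dimension stays below `n`, take the sum with
the next subspace, otherwise the intersection. -/
def euclidSubspace : List (Gr n m) → Submodule ℝ (EuclideanSpace ℝ (Fin n))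
  | [] => ⊥
  | V :: l => if Module.finrank ℝ (euclidSubspace l) + m < n then euclidSubspace l ⊔ V.1
      else euclidSubspace l ⊓ V.1

/-- Each member of the list is transversal to the subspaces which Euclid's algorithm makes out
of fewer than `n` of the later members. -/
def TransversalList (hmn : m ≤ n) (ρ : ℝ) (l : List (Gr n m)) : Prop :=
  ∀ V l', List.Sublist (V :: l') l → l'.length < n →
    ρ < dang V (comparableSubspace hmn (euclidSubspace l'))

/-- The reason for quantifying over all sublists: the n members finally used are only known after
the selection by double counting. -/
theorem TransversalList.sublist {hmn : m ≤ n} {ρ : ℝ} {l l' : List (Gr n m)}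
    (h : TransversalList hmn ρ l) (hl : List.Sublist l' l) : TransversalList hmn ρ l' :=
  fun V l'' hs => h V l'' (hs.trans hl)

variable {B : Finset (EuclideanSpace ℝ (Fin n))}

/-- `|B|` times the entropy of the projection to `U` of a random point of `B`, at scale `r`. -/
def entropyAt (B : Finset (EuclideanSpace ℝ (Fin n))) (r : ℝ)
    (U : Submodule ℝ (EuclideanSpace ℝ (Fin n))) : ℝ :=
  B.card * Real.log B.card - logSum B U.starProjection r

theorem entropyAt_bot {r : ℝ} (hr : 0 ≤ r) : entropyAt B r ⊥ = 0 := by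
  classical
  have : ∀ b ∈ B, nbrCount B (⊥ : Submodule ℝ (EuclideanSpace ℝ (Fin n))).starProjection r b
      = B.card := by
    intro b _
    simp [nbrCount, hr]
  unfold entropyAt logSum
  rw [Finset.sum_congr rfl fun b hb => by rw [this b hb]]
  simp

/-- The loss in the submodularity inequality for the entropies, per point. -/
def submodularityLoss (n : ℕ) (ρ : ℝ) : ℝ :=
  n * Real.log (4 * n * (2 * (2 * (n ^ 2 * n.factorial / ρ) + 1))) + n * Real.log (4 * n * 3)

/-- When U meets V nontrivially, no angle estimate holds between them. The estimate is only needed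
to control the projection to U + V, so a smaller U' with the same sum serves; the intersection needs
no angle. Restoring the common scale r costs the two terms of `submodularityLoss`. -/
theorem entropyAt_sup_add_inf_le (hn : 0 < n) {r ρ : ℝ} (hr : 0 < r) (hρ : 0 < ρ)
    {U U' V : Submodule ℝ (EuclideanSpace ℝ (Fin n))} (hU' : U' ≤ U) (hsup : U' ⊔ V = U ⊔ V)
    (h : ∀ v ∈ V, ∀ u ∈ U', ‖v‖ ≤ n ^ 2 * n.factorial / ρ * ‖v + u‖) :
    entropyAt B r (U ⊔ V) + entropyAt B r (U ⊓ V)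
      ≤ entropyAt B r U + entropyAt B r V + B.card * submodularityLoss n ρ := by
  set K : ℝ := n ^ 2 * n.factorial / ρ
  have hK : 0 ≤ K := by positivity
  have h1 := logSum_add_le (B := B) (P := U.starProjection) (Q := V.starProjection)
    (S := (U ⊔ V).starProjection) (I := (U ⊓ V).starProjection) (r' := (2 * K + 1) * (2 * r)) hr.le
    (by positivity) (fun x hP hQ => by
      exact (norm_starProjection_mono hsup.ge x).trans
        (norm_starProjection_sup_le hK h hQ ((norm_starProjection_mono hU' x).trans hP)))
    (norm_starProjection_mono inf_le_left) (norm_starProjection_mono inf_le_right)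
  have h2 := logSum_scale_le hn B (U ⊔ V).starProjection hr (t := 2 * (2 * K + 1)) (by linarith)
  have h3 := logSum_scale_le hn B (U ⊓ V).starProjection hr (t := 3) (by norm_num)
  have e : (2 * K + 1) * (2 * r) = 2 * (2 * K + 1) * r := by ring
  rw [e] at h1
  have h4 : (B.card : ℝ) * submodularityLoss n ρ =
      B.card * (n * Real.log (4 * n * (2 * (2 * K + 1)))) + B.card * (n * Real.log (4 * n * 3)) := by
    rw [submodularityLoss]; ring
  unfold entropyAt
  linarith

theorem norm_le_of_lt_dang (hmn : m ≤ n) {ρ : ℝ} (hρ : 0 < ρ) {V : Gr n m} {W : Gr n (n - m)}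
    (h : ρ < dang V W) {v w : EuclideanSpace ℝ (Fin n)} (hv : v ∈ V.1) (hw : w ∈ W.1) :
    ‖v‖ ≤ n ^ 2 * n.factorial / ρ * ‖v + w‖ := by
  rw [div_mul_eq_mul_div, le_div_iff₀ hρ, mul_comm]
  exact (mul_le_mul_of_nonneg_right h.le (norm_nonneg _)).trans (dang_mul_norm_le hmn V W hv hw)

theorem inf_eq_bot_of_lt_dang (hmn : m ≤ n) {ρ : ℝ} (hρ : 0 < ρ) {V : Gr n m} {W : Gr n (n - m)}
    (h : ρ < dang V W) : W.1 ⊓ V.1 = ⊥ := by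
  rw [Submodule.eq_bot_iff]
  intro v hv
  have := norm_le_of_lt_dang hmn hρ h hv.2 (W.1.neg_mem hv.1)
  simpa using this

/-- Here t counts the intersection steps. Each of them produces the whole space as the sum and
lowers the dimension by n - m, while a sum step raises it by m. -/
theorem entropyAt_euclidSubspace_le (hmn : m < n) {r ρ : ℝ} (hr : 0 < r) (hρ : 0 < ρ)
    (l : List (Gr n m)) (hl : l.length ≤ n) (ht : TransversalList hmn.le ρ l) :
    ∃ t : ℕ, Module.finrank ℝ (euclidSubspace l) + n * t = l.length * m ∧
      Module.finrank ℝ (euclidSubspace l) < n ∧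
      entropyAt B r (euclidSubspace l) + t * entropyAt B r ⊤
        ≤ (l.map fun V => entropyAt B r V.1).sum
          + l.length * (B.card * submodularityLoss n ρ) := by
  have hn : 0 < n := by omega
  induction l with
  | nil => 
    have e : euclidSubspace ([] : List (Gr n m)) = ⊥ := rfl
    refine ⟨0, ?_, ?_, ?_⟩ <;> rw [e]
    · simp
    · rwa [finrank_bot]
    · simp [entropyAt_bot hr.le]
  | cons V l ih =>
    obtain ⟨t, h1, h2, h3⟩ := ih (by simp at hl; omega) (ht.sublist (List.sublist_cons_self _ _))
    have hd := ht V l (List.Sublist.refl _) (by simp at hl; omega)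
    obtain ⟨hW1, hW2⟩ := (exists_comparable_subspace hmn.le (euclidSubspace l)).choose_spec
    set W := comparableSubspace hmn.le (euclidSubspace l) with hWdef
    have hWV := inf_eq_bot_of_lt_dang hmn.le hρ hd
    have hnorm : ∀ v ∈ V.1, ∀ w ∈ W.1, ‖v‖ ≤ n ^ 2 * n.factorial / ρ * ‖v + w‖ :=
      fun v hv w hw => norm_le_of_lt_dang hmn.le hρ hd hv hw
    have hV : Module.finrank ℝ V.1 = m := V.2
    have hWd : Module.finrank ℝ W.1 = n - m := W.2
    have hdim := Submodule.finrank_sup_add_finrank_inf_eq (euclidSubspace l) V.1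
    by_cases hlt : Module.finrank ℝ (euclidSubspace l) + m < n
    · have hUW : euclidSubspace l ≤ W.1 := hW1 hlt
      have hinf : euclidSubspace l ⊓ V.1 = ⊥ :=
        eq_bot_iff.2 (hWV ▸ inf_le_inf_right V.1 hUW)
      have hsub := entropyAt_sup_add_inf_le (B := B) hn hr hρ (le_refl (euclidSubspace l)) rfl
        (fun v hv u hu => hnorm v hv u (hUW hu))
      rw [hinf, entropyAt_bot hr.le] at hsub
      rw [hinf, finrank_bot] at hdim
      have e : euclidSubspace (V :: l) = euclidSubspace l ⊔ V.1 := if_pos hlt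
      refine ⟨t, ?_, ?_, ?_⟩
      · rw [e, List.length_cons, add_mul]; omega
      · rw [e]; omega
      · rw [e, List.length_cons, List.map_cons, List.sum_cons]
        push_cast
        linarith
    -- W and V have complementary dimensions and meet in 0, so they span ℝⁿ; W takes the role of U'.
    · have hWU : W.1 ≤ euclidSubspace l := hW2 (by omega)
      have htop : W.1 ⊔ V.1 = ⊤ := by
        refine Submodule.eq_top_of_finrank_eq ?_
        have := Submodule.finrank_sup_add_finrank_inf_eq W.1 V.1
        rw [hWV, finrank_bot] at this
        rw [finrank_euclideanSpace_fin]
        omega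
      have htop' : euclidSubspace l ⊔ V.1 = ⊤ :=
        eq_top_iff.2 (htop ▸ sup_le_sup_right hWU V.1)
      have hsub := entropyAt_sup_add_inf_le (B := B) hn hr hρ hWU (htop.trans htop'.symm) hnorm
      rw [htop'] at hsub
      rw [htop', finrank_top, finrank_euclideanSpace_fin] at hdim
      have e : euclidSubspace (V :: l) = euclidSubspace l ⊓ V.1 := if_neg hlt
      refine ⟨t + 1, ?_, ?_, ?_⟩
      · rw [e, List.length_cons, add_mul, mul_add]; omega
      · rw [e]; omega
      · rw [e, List.length_cons, List.map_cons, List.sum_cons]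
        push_cast
        linarith

/-- A Brascamp–Lieb type inequality for `n` projections of rank `m` in general position. -/
theorem mul_entropyAt_top_le (hmn : m < n) {r ρ : ℝ} (hr : 0 < r) (hρ : 0 < ρ)
    (l : List (Gr n m)) (hl : l.length = n) (ht : TransversalList hmn.le ρ l) :
    m * entropyAt B r ⊤ ≤ (l.map fun V => entropyAt B r V.1).sum
      + n * (B.card * submodularityLoss n ρ) := by
  obtain ⟨t, h1, h2, h3⟩ := entropyAt_euclidSubspace_le (B := B) hmn hr hρ l hl.le ht
  rw [hl] at h1 h3
  -- The dimension is a multiple of n below n.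
  have h0 : Module.finrank ℝ (euclidSubspace l) = 0 := by
    have hdvd : n ∣ Module.finrank ℝ (euclidSubspace l) :=
      (Nat.dvd_add_left (Dvd.intro t rfl)).1 (h1 ▸ Dvd.intro m rfl)
    exact Nat.eq_zero_of_dvd_of_lt hdvd h2
  have htm : t = m := by
    rw [h0, zero_add] at h1
    exact Nat.eq_of_mul_eq_mul_left (by omega) h1
  rw [Submodule.finrank_eq_zero] at h0
  rwa [h0, entropyAt_bot hr.le, zero_add, htm] at h3

end Geometry

/-! ### Selecting subspaces in general position and a common large subset -/

section Selection

variable {n m : ℕ}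

theorem card_toFinset_sublistsLen_le {ι : Type*} [DecidableEq ι] (l : List ι) (k : ℕ) :
    (List.sublistsLen k l).toFinset.card ≤ l.length ^ k := by
  refine (List.toFinset_card_le _).trans ?_
  rw [List.length_sublistsLen]
  exact Nat.choose_le_pow _ _

/-- If no neighbourhood of a degenerate locus has large measure, then a set of large (outer)
measure contains many subspaces in general position. -/
theorem exists_transversalList (hmn : m ≤ n) (μ : Measure (Gr n m)) [IsFiniteMeasure μ]
    {ρ p : ℝ} (hp : ∀ W, μ.real (Vang W ρ) ≤ p) (X : Set (Gr n m)) (M : ℕ)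
    (h : n * M ^ n * p < μ.real X) :
    ∃ l : List (Gr n m), l.length = M ∧ (∀ V ∈ l, V ∈ X) ∧ TransversalList hmn ρ l := by
  classical
  have hp0 : 0 ≤ p := by
    obtain ⟨W, -⟩ := exists_comparable_subspace (m := m) (n := n) hmn ⊥
    exact measureReal_nonneg.trans (hp W)
  suffices ∀ j ≤ M, ∃ l : List (Gr n m), l.length = j ∧ (∀ V ∈ l, V ∈ X) ∧
      TransversalList hmn ρ l from this M le_rfl
  intro j
  induction j with
  | zero => exact fun _ => ⟨[], rfl, by simp, fun V l' h' => by simp at h'⟩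
  | succ j ih =>
    intro hj
    obtain ⟨l, hlen, hX, ht⟩ := ih (by omega)
    -- The new subspace has to avoid one degenerate locus for each sublist with fewer than n
    -- members.
    set S := (Finset.range n).biUnion fun k => (List.sublistsLen k l).toFinset
    have hScard : S.card ≤ n * M ^ n := by
      refine Finset.card_biUnion_le.trans ?_
      calc ∑ k ∈ Finset.range n, (List.sublistsLen k l).toFinset.card
          ≤ ∑ k ∈ Finset.range n, M ^ n := by
            refine Finset.sum_le_sum fun k hk => (card_toFinset_sublistsLen_le l k).trans ?_
            exact (Nat.pow_le_pow_left (by omega) k).trans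
              (Nat.pow_le_pow_right (by omega) (Finset.mem_range.1 hk).le)
        _ = n * M ^ n := by simp
    set bad := ⋃ l' ∈ S, Vang (comparableSubspace hmn (euclidSubspace l')) ρ
    have hbad : μ.real bad ≤ n * M ^ n * p := by
      calc μ.real bad ≤ ∑ l' ∈ S, μ.real (Vang (comparableSubspace hmn (euclidSubspace l')) ρ) :=
            measureReal_biUnion_finset_le S _
        _ ≤ S.card • p := Finset.sum_le_card_nsmul _ _ _ fun l' _ => hp _
        _ ≤ n * M ^ n * p := by
            rw [nsmul_eq_mul]
            refine mul_le_mul_of_nonneg_right ?_ hp0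
            exact_mod_cast hScard
    -- Monotonicity of the outer measure is enough, so `X` need not be measurable.
    obtain ⟨V, hVX, hVbad⟩ : ∃ V ∈ X, V ∉ bad := by
      by_contra! hcon
      exact absurd (measureReal_mono (μ := μ) hcon (measure_ne_top μ _)) (by linarith)
    refine ⟨V :: l, by simp [hlen], ?_, ?_⟩
    · intro V' hV'
      rcases List.mem_cons.1 hV' with rfl | h'
      exacts [hVX, hX _ h']
    · intro V' l' hs hl'
      rcases List.cons_sublist_cons'.1 hs with h' | ⟨rfl, h'⟩
      · exact ht V' l' h' hl'
      · by_contra! hcon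
        refine hVbad (Set.mem_biUnion (x := l') ?_ hcon)
        exact Finset.mem_biUnion.2 ⟨l'.length, Finset.mem_range.2 hl',
          List.mem_toFinset.2 (List.mem_sublistsLen_self h')⟩

theorem sum_countP_mem {ι κ : Type*} [DecidableEq κ] (D : Finset κ) (F : ι → Finset κ)
    (l : List ι) (hF : ∀ V ∈ l, F V ⊆ D) :
    ∑ d ∈ D, l.countP (fun V => d ∈ F V) = (l.map fun V => (F V).card).sum := by
  induction l with
  | nil => simp
  | cons V l ih =>
    simp only [List.countP_cons, Finset.sum_add_distrib, List.map_cons, List.sum_cons]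
    rw [ih fun V' h' => hF V' (List.mem_cons_of_mem _ h'), add_comm]
    congr 1
    simp only [decide_eq_true_eq]
    rw [← Finset.sum_filter, Finset.filter_mem_eq_inter,
      Finset.inter_eq_right.2 (hF V List.mem_cons_self)]
    simp

/-- Many large subsets of a finite set: some `k` of them have a large intersection. -/
theorem exists_sublist_card_inter_ge {ι κ : Type*} [DecidableEq κ] {D : Finset κ}
    (hD : D.Nonempty) (F : ι → Finset κ) (l : List ι) {k : ℕ} (hk : 0 < k)
    {θ : ℝ} (hF : ∀ V ∈ l, F V ⊆ D) (hθ : ∀ V ∈ l, θ * D.card ≤ (F V).card)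
    (hl : 2 * k ≤ l.length * θ) :
    ∃ l', List.Sublist l' l ∧ l'.length = k ∧
      D.card ≤ l.length ^ (k + 1) * (D.filter fun d => ∀ V ∈ l', d ∈ F V).card := by
  classical
  have hDpos : 0 < D.card := hD.card_pos
  have hsum : 2 * k * D.card ≤ ∑ d ∈ D, l.countP (fun V => d ∈ F V) := by
    rw [sum_countP_mem D F l hF]
    have h1 : (l.length : ℝ) * (θ * D.card) ≤ (l.map fun V => ((F V).card : ℝ)).sum := by
      have := List.sum_le_sum (l := l) (f := fun _ => θ * (D.card : ℝ))
        (g := fun V => ((F V).card : ℝ)) hθ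
      simpa using this
    have h2 : (((l.map fun V => (F V).card).sum : ℕ) : ℝ) =
        (l.map fun V => ((F V).card : ℝ)).sum := by
      rw [Nat.cast_list_sum, List.map_map]; rfl
    have h3 : (2 * k * D.card : ℝ) ≤ l.length * (θ * D.card) := by
      rw [← mul_assoc]; gcongr
    exact_mod_cast (h3.trans h1).trans h2.ge
  set G := D.filter fun d => k ≤ l.countP (fun V => d ∈ F V)
  -- Points outside `G` account for at most k |D| of the at least 2k |D| incidences; the rest lie
  -- over `G`, at most `l.length` for each point.
  have hG : D.card ≤ l.length * G.card := by
    have h1 : ∑ d ∈ D, l.countP (fun V => d ∈ F V) ≤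
        ∑ d ∈ D, (k + if k ≤ l.countP (fun V => d ∈ F V) then l.length else 0) := by
      refine Finset.sum_le_sum fun d _ => ?_
      split_ifs with h
      · exact List.countP_le_length.trans (Nat.le_add_left _ _)
      · omega
    rw [Finset.sum_add_distrib, ← Finset.sum_filter, Finset.sum_const, Finset.sum_const,
      smul_eq_mul, smul_eq_mul] at h1
    have h2 : D.card ≤ k * D.card := Nat.le_mul_of_pos_left _ hk
    have h1' : ∑ d ∈ D, l.countP (fun V => d ∈ F V) ≤ D.card * k + G.card * l.length := h1
    have h3 : G.card * l.length = l.length * G.card := mul_comm _ _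
    have h4 : D.card * k = k * D.card := mul_comm _ _
    have h5 : 2 * k * D.card = k * D.card + k * D.card := by ring
    omega
  set S := (List.sublistsLen k l).toFinset
  have hGS : G ⊆ S.biUnion fun l' => D.filter fun d => ∀ V ∈ l', d ∈ F V := by
    intro d hd
    obtain ⟨hdD, hdk⟩ := Finset.mem_filter.1 hd
    set l₁ := l.filter fun V => d ∈ F V
    have hl₁ : k ≤ l₁.length := by rwa [← List.countP_eq_length_filter]
    refine Finset.mem_biUnion.2 ⟨l₁.take k, ?_, Finset.mem_filter.2 ⟨hdD, fun V hV => ?_⟩⟩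
    · exact List.mem_toFinset.2 (List.mem_sublistsLen.2
        ⟨(List.take_sublist _ _).trans List.filter_sublist, by simp [hl₁]⟩)
    · simpa using (List.mem_filter.1 (List.mem_of_mem_take hV)).2
  have hGne : G.Nonempty := by
    rw [← Finset.card_pos]
    by_contra h0
    have : G.card = 0 := by omega
    rw [this] at hG
    omega
  have hS : S.Nonempty := by
    obtain ⟨d, hd⟩ := hGne
    obtain ⟨l', hl', -⟩ := Finset.mem_biUnion.1 (hGS hd)
    exact ⟨l', hl'⟩
  by_contra! hcon
  have hlt : ∑ l' ∈ S, l.length ^ (k + 1) * (D.filter fun d => ∀ V ∈ l', d ∈ F V).card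
      < ∑ _l' ∈ S, D.card := by
    refine Finset.sum_lt_sum_of_nonempty hS fun l' hl' => ?_
    have := List.mem_sublistsLen.1 (List.mem_toFinset.1 hl')
    exact hcon l' this.1 this.2
  rw [← Finset.mul_sum, Finset.sum_const, smul_eq_mul] at hlt
  have h1 := (Finset.card_le_card hGS).trans Finset.card_biUnion_le
  have h2 : S.card ≤ l.length ^ k := card_toFinset_sublistsLen_le l k
  have h3 : S.card * D.card ≤ l.length ^ k * (l.length * G.card) := Nat.mul_le_mul h2 hG
  have h4 := Nat.mul_le_mul_left (l.length ^ (k + 1)) h1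
  rw [← mul_assoc, ← pow_succ] at h3
  omega

end Selection

/-! ### Covering numbers, grid representatives and entropy -/

section Covering

variable {n m : ℕ}

theorem Ncov_le_card {δ : ℝ} {A : Set (EuclideanSpace ℝ (Fin n))}
    {D : Finset (EuclideanSpace ℝ (Fin n))} (h : ∀ a ∈ A, ∃ d ∈ D, ‖a - d‖ ≤ δ) :
    Ncov δ A ≤ D.card := by
  have hc : Metric.IsCover δ.toNNReal A (D : Set (EuclideanSpace ℝ (Fin n))) := by
    intro a ha
    obtain ⟨d, hd, had⟩ := h a ha
    refine ⟨d, hd, ?_⟩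
    change edist a d ≤ _
    rw [edist_dist, dist_eq_norm]
    exact ENNReal.ofReal_le_ofReal had
  have := hc.externalCoveringNumber_le_encard
  rw [Set.encard_coe_eq_coe_finsetCard] at this
  exact ENat.toNat_le_of_le_natCast this

theorem exists_cover_card_eq_Ncov {δ : ℝ} (hδ : 0 < δ) {A : Set (EuclideanSpace ℝ (Fin n))}
    (hA : Bornology.IsBounded A) :
    ∃ D : Finset (EuclideanSpace ℝ (Fin n)), D.card = Ncov δ A ∧ ∀ a ∈ A, ∃ d ∈ D, ‖a - d‖ ≤ δ := by
  by_contra! hcon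
  have h : ((Ncov δ A + 1 : ℕ) : ℕ∞) ≤ Metric.externalCoveringNumber δ.toNNReal A := by
    refine le_iInf₂ fun C hC => ?_
    by_contra! hlt
    have hfin : C.Finite := Set.finite_of_encard_le_coe (k := Ncov δ A + 1) hlt.le
    have hcov : ∀ a ∈ A, ∃ d ∈ hfin.toFinset, ‖a - d‖ ≤ δ := by
      intro a ha
      obtain ⟨d, hd, had⟩ := hC ha
      change edist a d ≤ _ at had
      rw [edist_dist, dist_eq_norm] at had
      exact ⟨d, by simpa using hd, (ENNReal.ofReal_le_ofReal_iff hδ.le).1 had⟩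
    rw [hfin.encard_eq_coe_toFinset_card] at hlt
    have hlt' : hfin.toFinset.card < Ncov δ A + 1 := by exact_mod_cast hlt
    obtain ⟨a, ha, h'⟩ := hcon _
      (le_antisymm (Nat.lt_succ_iff.1 hlt') (Ncov_le_card hcov))
    obtain ⟨d, hd, had⟩ := hcov a ha
    exact absurd had (not_le.2 (h' d hd))
  rw [← Ncov_cast hδ hA] at h
  exact absurd h (by rw [Nat.cast_le]; omega)

/-- Representatives of the grid cells met by a bounded set. -/
theorem exists_gridCell_representatives {A : Set (EuclideanSpace ℝ (Fin n))}
    (hA : A ⊆ Metric.closedBall 0 1) {s : ℝ} (hs : 0 < s) :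
    ∃ D : Finset (EuclideanSpace ℝ (Fin n)), (∀ a ∈ A, ∃ d ∈ D, ‖a - d‖ ≤ n * s) ∧
      (D : Set _) ⊆ A ∧ Set.InjOn (gridCell s) (D : Set (EuclideanSpace ℝ (Fin n))) := by
  obtain ⟨D, hDA, hD⟩ := Set.exists_subset_bijOn A (gridCell s)
  have hfin : (gridCell s '' A).Finite := by
    refine (Finset.finite_toSet (Fintype.piFinset fun i =>
      Finset.Icc ⌊((0 : EuclideanSpace ℝ (Fin n)) i - 1) / s⌋
        ⌊((0 : EuclideanSpace ℝ (Fin n)) i + 1) / s⌋)).subset ?_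
    rintro _ ⟨a, ha, rfl⟩
    exact gridCell_mem_piFinset hs (by simpa using hA ha)
  have hDfin : D.Finite := hD.finite_iff_finite.2 hfin
  refine ⟨hDfin.toFinset, fun a ha => ?_, by simpa using hDA, by simpa using hD.injOn⟩
  obtain ⟨d, hd, hda⟩ := hD.surjOn (Set.mem_image_of_mem _ ha)
  exact ⟨d, by simpa using hd, norm_sub_le_of_gridCell_eq hs hda.symm⟩

theorem card_le_of_injOn_gridCell {s R : ℝ} (hs : 0 < s) (hR : 0 ≤ R)
    {D : Finset (EuclideanSpace ℝ (Fin n))} (c : EuclideanSpace ℝ (Fin n))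
    (hD : Set.InjOn (gridCell s) (D : Set (EuclideanSpace ℝ (Fin n))))
    (h : ∀ x ∈ D, ‖x - c‖ ≤ R) : (D.card : ℝ) ≤ (2 * R / s + 2) ^ n := by
  rw [← Finset.card_image_of_injOn hD]
  exact card_image_gridCell_le hs hR c D id h

theorem card_le_mul_Ncov {δ s : ℝ} (hδ : 0 < δ) (hs : 0 < s)
    {D : Finset (EuclideanSpace ℝ (Fin n))} {A : Set (EuclideanSpace ℝ (Fin n))}
    (hA : Bornology.IsBounded A) (hDA : (D : Set _) ⊆ A)
    (hD : Set.InjOn (gridCell s) (D : Set (EuclideanSpace ℝ (Fin n)))) :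
    (D.card : ℝ) ≤ (2 * δ / s + 2) ^ n * Ncov δ A := by
  classical
  obtain ⟨C, hC, hcov⟩ := exists_cover_card_eq_Ncov hδ hA
  have hsub : D ⊆ C.biUnion fun c => D.filter fun d => ‖d - c‖ ≤ δ := by
    intro d hd
    obtain ⟨c, hc, hdc⟩ := hcov d (hDA hd)
    exact Finset.mem_biUnion.2 ⟨c, hc, Finset.mem_filter.2 ⟨hd, hdc⟩⟩
  calc (D.card : ℝ) ≤ ∑ c ∈ C, ((D.filter fun d => ‖d - c‖ ≤ δ).card : ℝ) := by
        exact_mod_cast (Finset.card_le_card hsub).trans Finset.card_biUnion_le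
    _ ≤ C.card • (2 * δ / s + 2) ^ n := by
        refine Finset.sum_le_card_nsmul _ _ _ fun c _ => ?_
        exact card_le_of_injOn_gridCell hs hδ.le c
          (hD.mono fun x hx => (Finset.mem_filter.1 hx).1) fun x hx => (Finset.mem_filter.1 hx).2
    _ = (2 * δ / s + 2) ^ n * Ncov δ A := by rw [nsmul_eq_mul, hC, mul_comm]

/-- With at most one point per cell of side s, each r-ball contains boundedly many points when r/s
is bounded; the entropy is then log |B| up to a constant. -/
theorem le_entropyAt_top {B : Finset (EuclideanSpace ℝ (Fin n))} {s r : ℝ} (hs : 0 < s)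
    (hr : 0 ≤ r) (hB : Set.InjOn (gridCell s) (B : Set (EuclideanSpace ℝ (Fin n)))) :
    B.card * (Real.log B.card - n * Real.log (2 * r / s + 2)) ≤ entropyAt B r ⊤ := by
  classical
  have h : logSum B (⊤ : Submodule ℝ (EuclideanSpace ℝ (Fin n))).starProjection r ≤
      B.card • (n * Real.log (2 * r / s + 2)) := by
    refine Finset.sum_le_card_nsmul _ _ _ fun b hb => ?_
    rw [← Real.log_pow]
    refine Real.log_le_log (by exact_mod_cast nbrCount_pos hr hb) ?_
    refine card_le_of_injOn_gridCell hs hr b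
      (hB.mono fun x hx => (Finset.mem_filter.1 hx).1) fun x hx => ?_
    have := (Finset.mem_filter.1 hx).2
    rwa [norm_map_sub_comm, Submodule.starProjection_top, ContinuousLinearMap.id_apply] at this
  rw [nsmul_eq_mul] at h
  unfold entropyAt
  linarith

/-- Label each b by a δ-ball of the cover that contains the projection of a nearby a. Then b
projects to within 2δ of the centre, and points with the same label to within 4δ of each other. -/
theorem entropyAt_le_of_close {B : Finset (EuclideanSpace ℝ (Fin n))} (hB : B.Nonempty) {δ : ℝ}
    (hδ : 0 < δ) {A : Set (EuclideanSpace ℝ (Fin n))} (hA : Bornology.IsBounded A)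
    (hBA : ∀ b ∈ B, ∃ a ∈ A, ‖a - b‖ ≤ δ) (V : Gr n m) :
    entropyAt B (4 * δ) V.1 ≤ B.card * Real.log (Ncov δ (V.proj '' A)) := by
  classical
  obtain ⟨C, hC, hcov⟩ := exists_cover_card_eq_Ncov hδ
    (V.proj.lipschitz.isBounded_image hA)
  have hex : ∀ b ∈ B, ∃ c ∈ C, ‖V.1.starProjection b - c‖ ≤ 2 * δ := by
    intro b hb
    obtain ⟨a, ha, hab⟩ := hBA b hb
    obtain ⟨c, hc, hac⟩ := hcov _ (Set.mem_image_of_mem _ ha)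
    refine ⟨c, hc, ?_⟩
    have h1 : ‖V.1.starProjection (a - b)‖ ≤ δ := (V.1.norm_starProjection_apply_le _).trans hab
    have h2 : V.1.starProjection b - c =
        (V.1.starProjection a - c) - V.1.starProjection (a - b) := by rw [map_sub]; abel
    rw [Gr.proj_def] at hac
    rw [h2]
    linarith [norm_sub_le (V.1.starProjection a - c) (V.1.starProjection (a - b))]
  choose! g hgC hg using hex
  have := le_logSum_of_cover hB (L := V.1.starProjection) (r := 4 * δ) (by positivity) g
    (fun x hx y hy hxy => by
      have h1 := hg x hx
      have h2 := hg y hy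
      rw [hxy] at h1
      have h3 : V.1.starProjection (x - y) =
        (V.1.starProjection x - g y) - (V.1.starProjection y - g y) := by rw [map_sub]; abel
      rw [h3]
      linarith [norm_sub_le (V.1.starProjection x - g y) (V.1.starProjection y - g y)])
    (R := Ncov δ (V.proj '' A)) (by
      rw [← hC]
      exact_mod_cast Finset.card_le_card (Finset.image_subset_iff.2 hgC))
  unfold entropyAt
  linarith

end Covering

/-! ### The main estimate and the choice of constants -/

/-- The logarithm of the bound `N_δ(A) ^ m ≲ ∏ N_δ(π_V A)`, where each projection is
only controlled on a large part `S V` of the set. -/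
theorem mul_log_card_le {n m : ℕ} (hmn : m < n) {δ ρ θ R : ℝ} (hδ : 0 < δ) (hρ : 0 < ρ)
    {D : Finset (EuclideanSpace ℝ (Fin n))} (hDne : D.Nonempty)
    (hD : Set.InjOn (gridCell (δ / n)) (D : Set (EuclideanSpace ℝ (Fin n))))
    {l : List (Gr n m)} (ht : TransversalList hmn.le ρ l) (hl : 2 * n ≤ l.length * θ)
    (S : Gr n m → Set (EuclideanSpace ℝ (Fin n))) (F : Gr n m → Finset (EuclideanSpace ℝ (Fin n)))
    (hS : ∀ V ∈ l, Bornology.IsBounded (S V)) (hFD : ∀ V ∈ l, F V ⊆ D)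
    (hFS : ∀ V ∈ l, ∀ d ∈ F V, ∃ a ∈ S V, ‖a - d‖ ≤ δ)
    (hF : ∀ V ∈ l, θ * D.card ≤ (F V).card)
    (hR : ∀ V ∈ l, Real.log (Ncov δ (V.proj '' S V)) ≤ R) :
    m * (Real.log D.card - (n + 1) * Real.log l.length - n * Real.log (8 * n + 2))
      ≤ n * R + n * submodularityLoss n ρ := by
  classical
  have hn : 0 < n := by omega
  have hn' : (0 : ℝ) < n := by exact_mod_cast hn
  obtain ⟨l', hl', hlen, hcard⟩ := exists_sublist_card_inter_ge hDne F l hn hFD hF hl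
  set B := D.filter fun d => ∀ V ∈ l', d ∈ F V
  have hB : B.Nonempty := by
    rw [← Finset.card_pos]
    by_contra h0
    rw [Nat.eq_zero_of_not_pos h0, mul_zero] at hcard
    exact absurd hDne.card_pos (by omega)
  have hBc : (0 : ℝ) < B.card := by exact_mod_cast hB.card_pos
  have hDc : (0 : ℝ) < D.card := by exact_mod_cast hDne.card_pos
  have hlpos : (0 : ℝ) < l.length := by
    rcases Nat.eq_zero_or_pos l.length with h0 | h0
    · rw [h0, Nat.cast_zero, zero_mul] at hl
      linarith
    · exact_mod_cast h0
  have hlog : Real.log D.card ≤ (n + 1) * Real.log l.length + Real.log B.card := by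
    have h1 : (D.card : ℝ) ≤ l.length ^ (n + 1) * B.card := by exact_mod_cast hcard
    have h2 := Real.log_le_log hDc h1
    rw [Real.log_mul (by positivity) hBc.ne', Real.log_pow] at h2
    push_cast at h2
    exact h2
  have hBL := mul_entropyAt_top_le (B := B) hmn (r := 4 * δ) (by positivity) hρ l' hlen
    (ht.sublist hl')
  have htop := le_entropyAt_top (B := B) (s := δ / n) (r := 4 * δ) (by positivity) (by positivity)
    (hD.mono fun x hx => (Finset.mem_filter.1 hx).1)
  have e : 2 * (4 * δ) / (δ / n) + 2 = 8 * n + 2 := by field_simp; ring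
  rw [e] at htop
  have hsum : (l'.map fun V => entropyAt B (4 * δ) V.1).sum ≤ n * (B.card * R) := by
    have h1 : (l'.map fun V => entropyAt B (4 * δ) V.1).sum ≤ (l'.map fun _ => B.card * R).sum := by
      refine List.sum_le_sum fun V hV => ?_
      have hVl := hl'.subset hV
      refine (entropyAt_le_of_close hB hδ (hS V hVl) (fun b hb => ?_) V).trans
        (mul_le_mul_of_nonneg_left (hR V hVl) hBc.le)
      exact hFS V hVl b ((Finset.mem_filter.1 hb).2 V hV)
    simpa [hlen] using h1
  have h1 : B.card * (m * (Real.log B.card - n * Real.log (8 * n + 2))) ≤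
      B.card * (n * R + n * submodularityLoss n ρ) := by
    have := mul_le_mul_of_nonneg_left htop (Nat.cast_nonneg (α := ℝ) m)
    linarith
  refine le_trans ?_ (le_of_mul_le_mul_left h1 hBc)
  refine mul_le_mul_of_nonneg_left ?_ (Nat.cast_nonneg m)
  linarith

theorem submodularityLoss_le {n : ℕ} (hn : 0 < n) {ρ : ℝ} (hρ : 0 < ρ) (hρ1 : ρ ≤ 1) :
    submodularityLoss n ρ ≤
      n * (Real.log (24 * n * (n ^ 2 * n.factorial)) + Real.log (12 * n) - Real.log ρ) := by
  set X : ℝ := n ^ 2 * n.factorial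
  have hn' : (1 : ℝ) ≤ n := by exact_mod_cast hn
  have hX : 1 ≤ X := one_le_mul_of_one_le_of_one_le (one_le_pow₀ hn')
    (by exact_mod_cast n.factorial_pos)
  have hXρ : 1 ≤ X / ρ := (one_le_div hρ).2 (hρ1.trans hX)
  have h1 : Real.log (4 * n * (2 * (2 * (X / ρ) + 1))) ≤ Real.log (24 * n * X) - Real.log ρ := by
    rw [← Real.log_div (by positivity) hρ.ne']
    refine Real.log_le_log (by positivity) ?_
    have : 24 * n * X / ρ = 4 * n * (6 * (X / ρ)) := by ring
    rw [this]
    refine mul_le_mul_of_nonneg_left ?_ (by positivity)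
    linarith
  have h2 : (4 * n * 3 : ℝ) = 12 * n := by ring
  rw [submodularityLoss, h2, ← mul_add]
  refine mul_le_mul_of_nonneg_left ?_ (by positivity)
  linarith

/-- For m = n the projection is the identity, and a part of proportion δ^ε is already too large to
be exceptional. -/
theorem exceptionalSet_self_eq_empty {n : ℕ} (hn : 0 < n) {δ α ε C : ℝ} (hδ : 0 < δ)
    (hδ1 : δ < 1) (hε : 0 < ε) (hC : 2 ≤ C) {A : Set (EuclideanSpace ℝ (Fin n))}
    (hA : δ ^ (-α - C * ε) ≤ (Ncov δ A : ℝ)) : exceptionalSet n n δ α ε A = ∅ := by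
  rw [Set.eq_empty_iff_forall_notMem]
  rintro V ⟨A', -, h1, h2⟩
  have hV : V.1 = ⊤ := Submodule.eq_top_of_finrank_eq (by rw [V.2, finrank_euclideanSpace_fin])
  have hproj : V.proj '' A' = A' := by
    have : ∀ x, V.proj x = x := fun x => by
      rw [Gr.proj_def, Submodule.starProjection_eq_self_iff, hV]
      trivial
    simp [this]
  have hnn : (n : ℝ) / n = 1 := div_self (by exact_mod_cast hn.ne')
  rw [hproj, hnn, one_mul] at h2
  have h3 : δ ^ (-α - ε) ≤ δ ^ ε * (Ncov δ A : ℝ) := by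
    calc δ ^ (-α - ε) ≤ δ ^ (ε + (-α - C * ε)) :=
          Real.rpow_le_rpow_of_exponent_ge hδ hδ1.le (by nlinarith)
      _ = δ ^ ε * δ ^ (-α - C * ε) := Real.rpow_add hδ _ _
      _ ≤ _ := mul_le_mul_of_nonneg_left hA (by positivity)
  linarith

theorem measureReal_exceptionalSet_le {n m : ℕ} (hm : 0 < m) (hmn : m < n) {α κ ε δ a C : ℝ}
    (hε : 0 < ε) (hδ : 0 < δ) (ha : a * κ = n + 3) (ha0 : 0 < a) (haε : a * ε ≤ 1)
    (hC : 2 * n + 2 + n ^ 2 * a ≤ C)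
    (hδε : Real.log (n * (3 * n * (2 * n + 2) ^ n) ^ n) +
      (m * ((n + 1) * Real.log (3 * n * (2 * n + 2) ^ n) + n * Real.log (8 * n + 2)) +
        n ^ 2 * (Real.log (24 * n * (n ^ 2 * n.factorial)) + Real.log (12 * n)))
          < -(ε * Real.log δ))
    {A : Set (EuclideanSpace ℝ (Fin n))} (hA1 : A ⊆ Metric.closedBall 0 1)
    (μ : Measure (Gr n m)) [IsProbabilityMeasure μ]
    (hA : δ ^ (-α - C * ε) ≤ (Ncov δ A : ℝ))
    (hμ : ∀ ρ : ℝ, δ ≤ ρ → ∀ W : Gr n (n - m), μ.real (Vang W ρ) ≤ δ ^ (-ε) * ρ ^ κ) :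
    μ.real (exceptionalSet n m δ α ε A) ≤ δ ^ ε := by
  classical
  by_contra! hcon
  have hn : 0 < n := by omega
  have hn1 : (1 : ℝ) ≤ n := by exact_mod_cast hn
  have hm1 : (1 : ℝ) ≤ m := by exact_mod_cast hm
  have hbdd : Bornology.IsBounded A := Metric.isBounded_closedBall.subset hA1
  set c : ℝ := (2 * n + 2) ^ n
  have hc1 : 1 ≤ c := one_le_pow₀ (by linarith)
  set b : ℝ := 3 * n * c
  have hb1 : 1 ≤ b := by nlinarith
  have hlogb : 0 ≤ Real.log b := Real.log_nonneg hb1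
  have hlog1 : 0 ≤ Real.log (n * b ^ n) :=
    Real.log_nonneg (one_le_mul_of_one_le_of_one_le hn1 (one_le_pow₀ hb1))
  have hlog8 : 0 ≤ Real.log (8 * n + 2) := Real.log_nonneg (by linarith)
  have hlog12 : 0 ≤ Real.log (12 * n) := Real.log_nonneg (by linarith)
  have hlog24 : 0 ≤ Real.log (24 * n * (n ^ 2 * n.factorial)) := by
    refine Real.log_nonneg (one_le_mul_of_one_le_of_one_le (by linarith)
      (one_le_mul_of_one_le_of_one_le (one_le_pow₀ hn1) (by exact_mod_cast n.factorial_pos)))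
  have hK0 : 0 ≤ m * ((n + 1) * Real.log b + n * Real.log (8 * n + 2)) +
        n ^ 2 * (Real.log (24 * n * (n ^ 2 * n.factorial)) + Real.log (12 * n)) := by positivity
  -- All losses are measured in x = ε log(1/δ), so that e^x = δ^(-ε); by `hδε`, x exceeds all the
  -- constants.
  set x := -(ε * Real.log δ) with hx
  have hx0 : 0 < x := by linarith
  have hlogδ : Real.log δ < 0 := by
    by_contra! h
    have := mul_nonneg hε.le h
    linarith
  have hδ1 : δ < 1 := (Real.log_neg_iff hδ).1 hlogδ
  have hδe : δ ^ ε = Real.exp (-x) := by rw [Real.rpow_def_of_pos hδ, hx]; congr 1; ring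
  have hex1 : 1 ≤ Real.exp x := Real.one_le_exp hx0.le
  -- Each part has proportion at least θ = e^(-x)/c in `D`, and the double counting requires Mθ ≥
  -- 2n.
  set M := ⌈2 * n * c * Real.exp x⌉₊
  have hM1 : 2 * n * c * Real.exp x ≤ M := Nat.le_ceil _
  have hM2 : (M : ℝ) ≤ b * Real.exp x := by
    have h1 := (Nat.ceil_lt_add_one (show 0 ≤ 2 * n * c * Real.exp x by positivity)).le
    have h2 : 1 ≤ n * c * Real.exp x :=
      one_le_mul_of_one_le_of_one_le (one_le_mul_of_one_le_of_one_le hn1 hc1) hex1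
    have h3 : b * Real.exp x = 2 * n * c * Real.exp x + n * c * Real.exp x := by ring
    linarith
  set ρ := δ ^ (a * ε) with hρdef
  have hρ : 0 < ρ := Real.rpow_pos_of_pos hδ _
  have hρ1 : ρ ≤ 1 := Real.rpow_le_one hδ.le hδ1.le (by positivity)
  have hδρ : δ ≤ ρ := by
    calc δ = δ ^ (1 : ℝ) := (Real.rpow_one δ).symm
      _ ≤ ρ := Real.rpow_le_rpow_of_exponent_ge hδ hδ1.le haε
  have hlogρ : Real.log ρ = -(a * x) := by rw [hρdef, Real.log_rpow hδ, hx]; ring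
  have hp : δ ^ (-ε) * ρ ^ κ = Real.exp (-((n + 2) * x)) := by
    rw [hρdef, ← Real.rpow_mul hδ.le, ← Real.rpow_add hδ, Real.rpow_def_of_pos hδ, hx]
    congr 1
    have : a * ε * κ = (n + 3) * ε := by rw [← ha]; ring
    rw [this]
    ring
  -- Up to the factor n b^n, the left side is δ^(-nε) δ^((n+2)ε) = δ^(2ε). One spare factor δ^ε
  -- absorbs the constant.
  have hmeas : n * (M : ℝ) ^ n * (δ ^ (-ε) * ρ ^ κ) < μ.real (exceptionalSet n m δ α ε A) := by
    refine lt_of_le_of_lt ?_ hcon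
    rw [hp, hδe]
    calc n * (M : ℝ) ^ n * Real.exp (-((n + 2) * x))
        ≤ n * (b * Real.exp x) ^ n * Real.exp (-((n + 2) * x)) := by gcongr
      _ = n * b ^ n * Real.exp (-(2 * x)) := by
          rw [mul_pow, ← Real.exp_nat_mul, ← mul_assoc, mul_assoc (_ * _), ← Real.exp_add]
          congr 2
          ring
      _ ≤ Real.exp x * Real.exp (-(2 * x)) := by
          refine mul_le_mul_of_nonneg_right ?_ (Real.exp_pos _).le
          rw [← Real.log_le_iff_le_exp (by positivity)]
          linarith
      _ = Real.exp (-x) := by rw [← Real.exp_add]; congr 1; ring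
  obtain ⟨l, hlen, hlX, hlt⟩ := exists_transversalList hmn.le μ (hμ ρ hδρ) _ M hmeas
  obtain ⟨D, hDcov, hDA, hDinj⟩ := exists_gridCell_representatives hA1 (s := δ / n) (by positivity)
  have hns : n * (δ / n) = δ := by field_simp
  rw [hns] at hDcov
  have hNA : (0 : ℝ) < Ncov δ A := lt_of_lt_of_le (by positivity) hA
  have hND : (Ncov δ A : ℝ) ≤ D.card := by exact_mod_cast Ncov_le_card hDcov
  have hDne : D.Nonempty := Finset.card_pos.1 (by exact_mod_cast hNA.trans_le hND)
  have hDN : (D.card : ℝ) ≤ c * Ncov δ A := by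
    have h := card_le_mul_Ncov hδ (by positivity) hbdd hDA hDinj
    have e : 2 * δ / (δ / n) + 2 = 2 * n + 2 := by field_simp
    rwa [e] at h
  choose! S hSA hSN hSπ using fun V (hV : V ∈ exceptionalSet n m δ α ε A) => hV
  set F : Gr n m → Finset (EuclideanSpace ℝ (Fin n)) := fun V =>
    D.filter fun d => ∃ a ∈ S V, ‖a - d‖ ≤ δ
  have hFcard : ∀ V ∈ l, Real.exp (-x) / c * D.card ≤ (F V).card := by
    intro V hV
    have h1 : Ncov δ (S V) ≤ (F V).card := by
      refine Ncov_le_card fun a ha => ?_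
      obtain ⟨d, hd, had⟩ := hDcov a (hSA V (hlX V hV) ha)
      exact ⟨d, Finset.mem_filter.2 ⟨hd, a, ha, had⟩, had⟩
    have h3 := hSN V (hlX V hV)
    rw [hδe] at h3
    have h4 : (Ncov δ (S V) : ℝ) ≤ (F V).card := by exact_mod_cast h1
    refine le_trans ?_ (h3.trans h4)
    rw [div_mul_eq_mul_div, div_le_iff₀ (by positivity)]
    nlinarith [mul_le_mul_of_nonneg_left hDN (Real.exp_pos (-x)).le]
  have hFne : ∀ V ∈ l, (S V).Nonempty := by
    intro V hV
    have h1 : (0 : ℝ) < (F V).card := lt_of_lt_of_le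
      (mul_pos (by positivity) (by exact_mod_cast hDne.card_pos)) (hFcard V hV)
    obtain ⟨d, hd⟩ := Finset.card_pos.1 (by exact_mod_cast h1)
    obtain ⟨a, ha, -⟩ := (Finset.mem_filter.1 hd).2
    exact ⟨a, ha⟩
  have hSb : ∀ V ∈ l, Bornology.IsBounded (S V) := fun V hV => hbdd.subset (hSA V (hlX V hV))
  have hR : ∀ V ∈ l, Real.log (Ncov δ (V.proj '' S V)) ≤ ((m : ℝ) / n * α + ε) * -Real.log δ := by
    intro V hV
    have hpos : 0 < Ncov δ (V.proj '' S V) := by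
      have h1 := Ncov_cast hδ (V.proj.lipschitz.isBounded_image (hSb V hV))
      have h2 := Metric.externalCoveringNumber_pos_iff (ε := δ.toNNReal).2 ((hFne V hV).image V.proj)
      rw [← h1] at h2
      exact_mod_cast h2
    have h3 := Real.log_le_log (by exact_mod_cast hpos) (hSπ V (hlX V hV)).le
    rw [Real.log_rpow hδ] at h3
    linarith
  have hlθ : 2 * (n : ℝ) ≤ l.length * (Real.exp (-x) / c) := by
    rw [hlen, Real.exp_neg, ← mul_div_assoc, le_div_iff₀ (by positivity), ← div_eq_mul_inv,
      le_div_iff₀ (Real.exp_pos x)]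
    exact hM1
  have hmain := mul_log_card_le hmn hδ hρ hDne hDinj hlt hlθ S F hSb
    (fun V _ => Finset.filter_subset _ _) (fun V _ d hd => (Finset.mem_filter.1 hd).2) hFcard hR
  have hloss := submodularityLoss_le hn hρ hρ1
  rw [hlogρ] at hloss
  have hDlog : α * -Real.log δ + C * x ≤ Real.log D.card := by
    have := Real.log_le_log (Real.rpow_pos_of_pos hδ _) (hA.trans hND)
    rw [Real.log_rpow hδ] at this
    have e : (-α - C * ε) * Real.log δ = α * -Real.log δ + C * x := by rw [hx]; ring
    linarith
  have hMpos : (0 : ℝ) < M := lt_of_lt_of_le (by positivity) hM1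
  have hMlog : Real.log M ≤ Real.log b + x := by
    have := Real.log_le_log hMpos hM2
    rwa [Real.log_mul (by positivity) (Real.exp_pos x).ne', Real.log_exp] at this
  rw [hlen] at hmain
  have h1 : m * (α * -Real.log δ + C * x - (n + 1) * (Real.log b + x) - n * Real.log (8 * n + 2)) ≤
      n * (((m : ℝ) / n * α + ε) * -Real.log δ) +
      n * (n * (Real.log (24 * n * (n ^ 2 * n.factorial)) + Real.log (12 * n) - -(a * x))) := by
    refine le_trans ?_ (hmain.trans ?_)
    · refine mul_le_mul_of_nonneg_left ?_ (by positivity)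
      have := mul_le_mul_of_nonneg_left hMlog (show (0 : ℝ) ≤ n + 1 by positivity)
      linarith
    · have := mul_le_mul_of_nonneg_left hloss (show (0 : ℝ) ≤ n by positivity)
      linarith
  -- The exponent (m/n)α is the one for which n projections produce mα, cancelling the main term on
  -- the left.
  have h2 : n * (((m : ℝ) / n * α + ε) * -Real.log δ) = m * (α * -Real.log δ) + n * x := by
    rw [hx]; field_simp; ring
  rw [h2] at h1
  have h3 : x * (m * (C - (n + 1)) - n - n ^ 2 * a) ≤
      m * ((n + 1) * Real.log b + n * Real.log (8 * n + 2)) +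
        n ^ 2 * (Real.log (24 * n * (n ^ 2 * n.factorial)) + Real.log (12 * n)) := by
    linarith
  -- With coefficient at least 1, `h3` bounds x by constants that it exceeds.
  have h4 : 1 ≤ m * (C - (n + 1)) - n - n ^ 2 * a := by
    have h5 : (n : ℝ) + 1 + n ^ 2 * a ≤ C - (n + 1) := by linarith
    have h6 : 0 ≤ C - (n + 1) := by
      have : 0 ≤ (n : ℝ) ^ 2 * a := by positivity
      linarith
    linarith [le_mul_of_one_le_left h6 hm1]
  have h5 := mul_le_mul_of_nonneg_left h4 hx0.le
  linarith

end

theorem proposition16 (n m : ℕ) (hm : 0 < m) (hmn : m ≤ n) (α κ : ℝ) (hα : 0 < α)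
    (hαn : α < n) (hκ : 0 < κ) :
    ∃ C : ℝ, 1 < C ∧ ∀ ε : ℝ, 0 < ε → ε < κ / C →
      ∃ δ₀ : ℝ, 0 < δ₀ ∧ ∀ δ : ℝ, 0 < δ → δ < δ₀ →
        ∀ A : Set (EuclideanSpace ℝ (Fin n)), A ⊆ Metric.closedBall 0 1 →
        ∀ (μ : Measure (Gr n m)) [IsProbabilityMeasure μ],
          δ ^ (-α - C * ε) ≤ (Ncov δ A : ℝ) →
          (m < n → ∀ ρ : ℝ, δ ≤ ρ → ∀ W : Gr n (n - m),
            μ.real (Vang W ρ) ≤ δ ^ (-ε) * ρ ^ κ) →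
          μ.real (exceptionalSet n m δ α ε A) ≤ δ ^ ε := by
  have hn : 0 < n := by omega
  set a : ℝ := (n + 3) / κ
  have ha0 : 0 < a := by positivity
  have ha : a * κ = n + 3 := div_mul_cancel₀ _ hκ.ne'
  -- C ≥ n + 3 gives aε ≤ 1, hence ρ = δ^(aε) ≥ δ, where the hypothesis on μ applies; C ≥ 2 serves m
  -- = n, and the third bound the final comparison.
  set C : ℝ := 3 * n + 5 + n ^ 2 * a
  have hC : (n : ℝ) + 3 ≤ C ∧ 2 ≤ C ∧ 2 * n + 2 + n ^ 2 * a ≤ C := by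
    have : 0 ≤ (n : ℝ) ^ 2 * a := by positivity
    have : (0 : ℝ) ≤ n := by positivity
    refine ⟨?_, ?_, ?_⟩ <;> linarith
  refine ⟨C, by linarith [hC.2.1], fun ε hε hεC => ?_⟩
  have hC0 : 0 < C := by linarith [hC.2.1]
  have haε : a * ε ≤ 1 := by
    rw [lt_div_iff₀ hC0] at hεC
    rw [div_mul_eq_mul_div, div_le_one hκ]
    nlinarith [mul_le_mul_of_nonneg_left hC.1 hε.le]
  set K : ℝ := Real.log (n * (3 * n * (2 * n + 2) ^ n) ^ n) +
      (m * ((n + 1) * Real.log (3 * n * (2 * n + 2) ^ n) + n * Real.log (8 * n + 2)) +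
        n ^ 2 * (Real.log (24 * n * (n ^ 2 * n.factorial)) + Real.log (12 * n)))
  -- δ < exp(-K/ε) means ε log(1/δ) > K; δ < 1 is needed for m = n.
  refine ⟨min 1 (Real.exp (-(K / ε))), by positivity, fun δ hδ hδ₀ A hA1 μ _ hA hμ => ?_⟩
  rcases hmn.eq_or_lt with rfl | hlt
  · rw [exceptionalSet_self_eq_empty hn hδ (hδ₀.trans_le (min_le_left _ _)) hε hC.2.1 hA,
      measureReal_empty]
    positivity
  · refine measureReal_exceptionalSet_le hm hlt hε hδ ha ha0 haε hC.2.2 ?_ hA1 μ hA (hμ hlt)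
    have h2 : Real.log δ < -(K / ε) := (Real.log_lt_iff_lt_exp hδ).2 (hδ₀.trans_le (min_le_right _ _))
    have h3 := mul_lt_mul_of_pos_left h2 hε
    have h4 : ε * -(K / ε) = -K := by field_simp
    linarith
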